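/- **Theorem (Canonical decomposition).** Write $\|\cdot\|$ for the Euclidean norm on $\mathbb R^n$ and $\bar{\mathbb B}^n=\{x\in\mathbb R^n:\|x\|\le 1\}$. For $n\ge 0$ and $b>n/2$ (with $b>0$) put $\tilde c_{n,b}=\dfrac{\Gamma(b)}{\pi^{n/2}\,\Gamma(b-n/2)}$. For $n\ge1$, $a>0$, $b>n/2$ let $\Phi_{n,a,b}$ be the measure on $\mathbb R^n\setminus\bar{\mathbb B}^n$ with Lebesgue density $$f_{n,a,b}(x)=\frac{a\,\tilde c_{n,b}}{(\|x\|^2-1)^{b}},\qquad \|x\|>1,$$ and let $\tilde f_{n,b}(z)=\tilde c_{n,b}(1+\|z\|^2)^{-b}$, $z\in\mathbb R^n$. Let $d\ge 1$, $k\in\{1,\dots,d\}$, $\alpha>0$ and $\beta>d/2$. Let $A(d,\ell)$ be the Grassmannian of $\ell$-dimensional affine subspaces of $\mathbb R^d$ with its usual topology and Borel $\sigma$-algebra. For $E\in A(d,\ell)$ let $\pi_E:\mathbb R^d\to E$ be the orthogonal projection, $p(E)=\pi_E(0)$ and $\operatorname{dist}(E)=\|p(E)\|$. For $\ell=k-1$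 and for $\ell=d-k+1$ fix any isometries $I_E:E\to\mathbb R^{\ell}$, $E\in A(d,\ell)$, such that $I_E(p(E))=0$ and $(x,E)\mapsto I_E(\pi_E(x))$ is a measurable map $\mathbb R^d\times A(d,\ell)\to\mathbb R^{\ell}$. For $x=(x_1,\dots,x_k)\in(\mathbb R^d)^k$ let $A_x=\operatorname{aff}(x_1,\dots,x_k)$, and let $$\mathcal S_{k,d}=\{x\in(\mathbb R^d)^k:\ A_x\cap\bar{\mathbb B}^d=\varnothing,\ \dim A_x=k-1\}.$$ For $x\in\mathcal S_{k,d}$ let $A_x^\perp\in A(d,d-k+1)$ be the linear subspace orthogonal to the direction space of $A_x$, and put $T(x)=(T_1(x),T_2(x))$ with $$T_1(x)=\left(\frac{I_{A_x}(x_1)}{\sqrt{\operatorname{dist}^2(A_x)-1}},\dots,\frac{I_{A_x}(x_k)}{\sqrt{\operatorname{dist}^2(A_x)-1}}\right)\in(\mathbb R^{k-1})^k,\qquad T_2(x)=I_{A_x^\perp}(p(A_x))\in\mathbb R^{d-k+1}\setminus\bar{\mathbb B}^{d-k+1}.$$ Let $\mu=\big(\bigotimes_{i=1}^k\Phi_{d,\alpha,\beta}\big)\big|_{\mathcal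 S_{k,d}}$ be the restriction to $\mathcal S_{k,d}$ of the $k$-fold product measure. Then: (a) $\mu\circ T^{-1}=\phi_{k-1}\otimes(\mu\circ T_2^{-1})$, where $\phi_{k-1}$ is a probability measure on $(\mathbb R^{k-1})^k$ whose Lebesgue density is the normalization to total mass $1$ of $$(z_1,\dots,z_k)\mapsto V_{k-1}\big(\operatorname{conv}(z_1,\dots,z_k)\big)^{d-k+1}\prod_{i=1}^k\tilde f_{k-1,\beta}(z_i),$$ $V_{k-1}$ being the $(k-1)$-dimensional volume (in particular, the integral of this function is positive and finite; for $k=1$, $\mathbb R^0$ is a point, with Lebesgue measure the unit mass). (b) $\mu\circ T_2^{-1}=\Phi_{d-k+1,\ \alpha^k,\ k\beta-\frac{(d+1)(k-1)}{2}}$; that is, $\mu\circ T_2^{-1}$ has Lebesgue density $f_{d-k+1,\,\alpha^k,\,k\beta-(d+1)(k-1)/2}$ on $\mathbb R^{d-k+1}\setminus\bar{\mathbb B}^{d-k+1}$. -/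

import Mathlib

open MeasureTheory

noncomputable section

namespace BetaStar

/-- Euclidean space `ℝⁿ`, with the Euclidean norm and Lebesgue measure as `volume`. -/
abbrev Euc (n : ℕ) : Type := EuclideanSpace ℝ (Fin n)

/-! ### Beta-star and beta-prime densities -/

/-- The constant `c̃_{d,β} = Γ(β) / (π^{d/2} Γ(β - d/2))`. -/
def cTilde (d : ℕ) (β : ℝ) : ℝ :=
  Real.Gamma β / (Real.pi ^ ((d : ℝ) / 2) * Real.Gamma (β - (d : ℝ) / 2))

/-- The beta-star intensity `f_{d,α,β}`; it is only used at points with `‖x‖ > 1`. -/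
def betaStarDensity (d : ℕ) (α β : ℝ) (x : Euc d) : ℝ :=
  α * cTilde d β / (‖x‖ ^ 2 - 1) ^ β

/-- The beta-star measure `Φ_{d,α,β}`: it lives on the complement of the closed unit ball and has
density `f_{d,α,β}` there with respect to Lebesgue measure. -/
def betaStarMeasure (d : ℕ) (α β : ℝ) : Measure (Euc d) :=
  (volume.restrict (Metric.closedBall (0 : Euc d) 1)ᶜ).withDensity
    fun x => ENNReal.ofReal (betaStarDensity d α β x)

instance (d : ℕ) (α β : ℝ) : SigmaFinite (betaStarMeasure d α β) := by
  unfold betaStarMeasure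
  infer_instance

/-- The beta-prime density `f̃_{n,β}` on `ℝⁿ`. -/
def betaPrimeDensity (n : ℕ) (β : ℝ) (z : Euc n) : ℝ :=
  cTilde n β * (1 + ‖z‖ ^ 2) ^ (-β)

/-! ### The affine Grassmannian -/

/-- `A(d,ℓ)`: the (nonempty) `ℓ`-dimensional affine subspaces of `ℝᵈ`. -/
def AffGr (d ℓ : ℕ) : Type :=
  {E : AffineSubspace ℝ (Euc d) // (E : Set (Euc d)).Nonempty ∧ Module.finrank ℝ E.direction = ℓ}

variable {d ℓ : ℕ}

/-- The orthogonal projection `π_E : ℝᵈ → E`. -/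
def AffGr.proj (E : AffGr d ℓ) (x : Euc d) : E.1 :=
  haveI : Nonempty E.1 := E.2.1.to_subtype
  EuclideanGeometry.orthogonalProjection E.1 x

/-- The foot point `p(E) = π_E(0)`. -/
def AffGr.foot (E : AffGr d ℓ) : E.1 := E.proj 0

/-- The distance of `E` from the origin, `dist(E) = ‖p(E)‖`. -/
def AffGr.dist (E : AffGr d ℓ) : ℝ := ‖(E.foot : Euc d)‖

/-- The usual topology of the affine Grassmannian, the one of the metric
`‖P_E - P_F‖ + ‖p(E) - p(F)‖`, where `P_E` is the orthogonal projection onto the direction space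
of `E`. -/
instance : TopologicalSpace (AffGr d ℓ) :=
  TopologicalSpace.induced
    (fun E => ((E.1.direction.starProjection, (E.foot : Euc d)) :
      (Euc d →L[ℝ] Euc d) × Euc d))
    inferInstance

instance : MeasurableSpace (AffGr d ℓ) := borel (AffGr d ℓ)

instance : BorelSpace (AffGr d ℓ) := ⟨rfl⟩

/-- A choice of isometric identifications `I_E : E → ℝ^ℓ`, one for each `E ∈ A(d,ℓ)`, with
`I_E(p(E)) = 0` and such that `(x, E) ↦ I_E(π_E(x))` is Borel measurable. -/
structure IsometrySystem (d ℓ : ℕ) where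
  /-- The map `I_E`. -/
  toFun : (E : AffGr d ℓ) → E.1 → Euc ℓ
  isometry : ∀ E, Isometry (toFun E)
  map_foot : ∀ E, toFun E E.foot = 0
  measurable : Measurable fun q : Euc d × AffGr d ℓ => toFun q.2 (q.2.proj q.1)

/-- For `1 ≤ k ≤ d`, the orthogonal complement `E^⊥ ∈ A(d,d-k+1)` of `E ∈ A(d,k-1)`: the linear
subspace orthogonal to the direction space of `E`. -/
def AffGr.perp {d k : ℕ} (hk : 1 ≤ k) (hkd : k ≤ d) (E : AffGr d (k - 1)) :
    AffGr d (d - k + 1) :=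
  ⟨(E.1.directionᗮ).toAffineSubspace, ⟨0, E.1.directionᗮ.zero_mem⟩, by
    have h := Submodule.finrank_add_finrank_orthogonal E.1.direction
    rw [E.2.2, finrank_euclideanSpace_fin] at h
    rw [Submodule.toAffineSubspace_direction]
    omega⟩

theorem AffGr.foot_mem_perp {d k : ℕ} (hk : 1 ≤ k) (hkd : k ≤ d) (E : AffGr d (k - 1)) :
    (E.foot : Euc d) ∈ (E.perp hk hkd).1 := by
  have : Nonempty E.1 := E.2.1.to_subtype
  have h := EuclideanGeometry.orthogonalProjection_vsub_mem_direction_orthogonal E.1 (0 : Euc d)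
  rw [vsub_eq_sub, sub_zero] at h
  exact h

/-! ### Tuples and the transformation `T` -/

/-- `S_{k,d}`: the `k`-tuples of points of `ℝᵈ` whose affine hull has dimension `k - 1` and does not
meet the closed unit ball. -/
def tupleSet (k d : ℕ) : Set (Fin k → Euc d) :=
  {x | (affineSpan ℝ (Set.range x) : Set (Euc d)) ∩ Metric.closedBall 0 1 = ∅ ∧
    Module.finrank ℝ (affineSpan ℝ (Set.range x)).direction = k - 1}

/-- The affine hull `A_x` of a tuple `x ∈ S_{k,d}`, as an element of `A(d,k-1)`. -/
def hull {k d : ℕ} (hk : 1 ≤ k) (x : tupleSet k d) : AffGr d (k - 1) :=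
  ⟨affineSpan ℝ (Set.range x.1), ⟨x.1 ⟨0, hk⟩, mem_affineSpan ℝ ⟨_, rfl⟩⟩, x.2.2⟩

/-- `T₁(x) = (I_{A_x}(x_i) / √(dist²(A_x) - 1))_{i=1,…,k}`. -/
def T₁ {k d : ℕ} (hk : 1 ≤ k) (I : IsometrySystem d (k - 1)) (x : tupleSet k d) :
    Fin k → Euc (k - 1) :=
  fun i => (Real.sqrt ((hull hk x).dist ^ 2 - 1))⁻¹ •
    I.toFun (hull hk x) ⟨x.1 i, mem_affineSpan ℝ ⟨i, rfl⟩⟩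

/-- `T₂(x) = I_{A_x^⊥}(p(A_x))`. -/
def T₂ {k d : ℕ} (hk : 1 ≤ k) (hkd : k ≤ d) (J : IsometrySystem d (d - k + 1))
    (x : tupleSet k d) : Euc (d - k + 1) :=
  J.toFun ((hull hk x).perp hk hkd) ⟨(hull hk x).foot, (hull hk x).foot_mem_perp hk hkd⟩

/-- `T(x) = (T₁(x), T₂(x))`. -/
def T {k d : ℕ} (hk : 1 ≤ k) (hkd : k ≤ d) (I : IsometrySystem d (k - 1))
    (J : IsometrySystem d (d - k + 1)) (x : tupleSet k d) :
    (Fin k → Euc (k - 1)) × Euc (d - k + 1) :=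
  (T₁ hk I x, T₂ hk hkd J x)

/-- The values of `T₂` lie outside the closed unit ball. -/
theorem one_lt_norm_T₂ {k d : ℕ} (hk : 1 ≤ k) (hkd : k ≤ d) (J : IsometrySystem d (d - k + 1))
    (x : tupleSet k d) : 1 < ‖T₂ hk hkd J x‖ := by
  set E := hull hk x with hE
  set F := E.perp hk hkd with hF
  have h0 : ((F.foot : F.1) : Euc d) = 0 := by
    have : Nonempty F.1 := F.2.1.to_subtype
    have hz : (0 : Euc d) ∈ F.1 := E.1.directionᗮ.zero_mem
    exact EuclideanGeometry.orthogonalProjection_eq_self_iff.2 hz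
  have h1 : ‖T₂ hk hkd J x‖ = ‖(E.foot : Euc d)‖ := by
    have h2 := (J.isometry F).dist_eq ⟨E.foot, E.foot_mem_perp hk hkd⟩ F.foot
    rw [J.map_foot, dist_zero_right, Subtype.dist_eq, h0, dist_zero_right] at h2
    exact h2
  rw [h1]
  by_contra hcon
  have hmem : (E.foot : Euc d) ∈
      (affineSpan ℝ (Set.range x.1) : Set (Euc d)) ∩ Metric.closedBall 0 1 :=
    ⟨E.foot.2, by simpa using hcon⟩
  rw [x.2.1] at hmem
  exact hmem

/-! ### The measures of the decomposition -/

/-- The restriction of the `k`-fold product of `Φ_{d,α,β}` to `S_{k,d}`, as a measure on `S_{k,d}`. -/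
def tupleMeasure (k d : ℕ) (α β : ℝ) : Measure (tupleSet k d) :=
  (Measure.pi fun _ : Fin k => betaStarMeasure d α β).comap Subtype.val

/-- The function `V_{k-1}^{d-k+1}(conv(z_1,…,z_k)) ∏ f̃_{k-1,β}(z_i)` on `(ℝ^{k-1})^k`; here
`V_{k-1}` is Lebesgue measure on `ℝ^{k-1}`. -/
def simplexWeight (d k : ℕ) (β : ℝ) (z : Fin k → Euc (k - 1)) : ENNReal :=
  volume (convexHull ℝ (Set.range z)) ^ (d - k + 1) *
    ∏ i, ENNReal.ofReal (betaPrimeDensity (k - 1) β (z i))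

/-- The measure on `(ℝ^{k-1})^k` whose Lebesgue density is `simplexWeight`, normalized by its
total integral. -/
def simplexMeasure (d k : ℕ) (β : ℝ) : Measure (Fin k → Euc (k - 1)) :=
  volume.withDensity fun z => (∫⁻ w, simplexWeight d k β w)⁻¹ * simplexWeight d k β z

end BetaStar

end

open MeasureTheory
open scoped ENNReal

noncomputable section

namespace BetaStar

/-! ### Linear changes of variables -/

section LinearChange

variable {E : Type*} [NormedAddCommGroup E] [NormedSpace ℝ E] [FiniteDimensional ℝ E]
  [MeasurableSpace E] [BorelSpace E]

/-! Write `k = m + 1` and `d = m + q`. Split ℝᵈ as ℝᵐ × ℝ^q. If the ℝᵐ-parts of the points of a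
tuple are affinely independent, the tuple lies on the graph of a unique affine map, and the
parameters are its slope `a`, the parameter `y` of the foot point, and the positions `u` of the
points over ℝᵐ. `lintegral_tuple_eq` is Fubini together with this linear change of variables; it is
a Blaschke-Petkantschin formula without invariant measures on Grassmannians.

The flat is orthogonal to its foot vector, so with `s = dist² + σ` each weight satisfies `‖xᵢ‖² + σ
= s (1 + ‖zᵢ‖²)`, where `zᵢ` is the in-flat position divided by `√s`. Passing to `z` therefore
separates the in-flat shape from the foot. The powers of `s` from the weights, from the substitution
and from the simplex volume combine to the exponent `(m + 1)β - m(m + 1 + q)/2`. The isometries of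
the two systems are affine and contribute only determinants depending on `a`, so the slope survives
only as a constant factor, the integral of `graphJacobian`. This is `lintegral_flatSet`, valid for
every real `σ`.

That constant is never computed. For `σ = 1` and test function 1, every integral except it and the
total weight of the simplices is an explicit beta-prime integral, so their product is determined
(`lintegral_graphJacobian_mul`), and the simplex weight is seen to have positive finite integral.
Inserting this value into the case `σ = -1`, which is the beta-star measure, gives the product form
with exactly the stated constants (`map_pi_betaStarMeasure`). -/

theorem lintegral_comp_linearMap (μ : Measure E) [μ.IsAddHaarMeasure] {f : E →ₗ[ℝ] E}
    (hf : LinearMap.det f ≠ 0) (F : E → ℝ≥0∞) :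
    ∫⁻ x, F x ∂μ = ENNReal.ofReal |LinearMap.det f| * ∫⁻ x, F (f x) ∂μ := by
  have hmap := Measure.map_linearMap_addHaar_eq_smul_addHaar μ hf
  have hemb : MeasurableEmbedding f := by
    have : (f : E → E) = (LinearMap.equivOfDetNeZero f hf).toContinuousLinearEquiv := rfl
    rw [this]
    exact (LinearMap.equivOfDetNeZero f hf).toContinuousLinearEquiv.toHomeomorph.measurableEmbedding
  rw [← hemb.lintegral_map, hmap, lintegral_smul_measure, smul_eq_mul, ← mul_assoc,
    ← ENNReal.ofReal_mul (abs_nonneg _), abs_inv, mul_inv_cancel₀ (abs_ne_zero.2 hf),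
    ENNReal.ofReal_one, one_mul]

/-- Apply a linear map to each member of a finite family. -/
def piLinear (n : ℕ) (L : E →ₗ[ℝ] E) : (Fin n → E) →ₗ[ℝ] (Fin n → E) :=
  LinearMap.pi fun i => L.comp (LinearMap.proj i)

omit [MeasurableSpace E] [BorelSpace E] in
theorem det_piLinear (n : ℕ) (L : E →ₗ[ℝ] E) :
    LinearMap.det (piLinear n L) = LinearMap.det L ^ n := by
  unfold piLinear
  rw [LinearMap.det_pi]
  simp

end LinearChange

/-! ### Linear maps given by their columns -/

section Columns

variable {m : ℕ} {W : Type*} [NormedAddCommGroup W] [NormedSpace ℝ W]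

/-- The linear map `ℝᵐ → W` with columns `a`. -/
def colMap (a : Fin m → W) : Euc m →L[ℝ] W :=
  ∑ j, (EuclideanSpace.proj j : Euc m →L[ℝ] ℝ).smulRight (a j)

theorem colMap_apply (a : Fin m → W) (u : Euc m) : colMap a u = ∑ j, u j • a j := by
  simp [colMap]

@[simp] theorem colMap_single (a : Fin m → W) (j : Fin m) :
    colMap a (EuclideanSpace.single j 1) = a j := by
  simp [colMap_apply]

theorem continuous_colMap : Continuous fun a : Fin m → W => colMap a := by
  unfold colMap
  refine continuous_finsetSum _ fun j _ => ?_
  exact ((ContinuousLinearMap.smulRightL ℝ (Euc m) W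
    (EuclideanSpace.proj j : Euc m →L[ℝ] ℝ)).continuous).comp (continuous_apply j)

theorem colMap_comp {W' : Type*} [NormedAddCommGroup W'] [NormedSpace ℝ W'] (f : W →ₗ[ℝ] W')
    (a : Fin m → W) (u : Euc m) : colMap (fun j => f (a j)) u = f (colMap a u) := by
  simp [colMap_apply]

theorem range_colMap (a : Fin m → W) :
    LinearMap.range (colMap a).toLinearMap = Submodule.span ℝ (Set.range a) := by
  apply le_antisymm
  · rintro _ ⟨u, rfl⟩
    change colMap a u ∈ _
    rw [colMap_apply]
    exact Submodule.sum_mem _ fun j _ => Submodule.smul_mem _ _ (Submodule.subset_span ⟨j, rfl⟩)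
  · rw [Submodule.span_le]
    rintro _ ⟨j, rfl⟩
    exact ⟨EuclideanSpace.single j 1, colMap_single a j⟩

/-- The edges `x_j - x_0` of a tuple `(x_0, …, x_m)`. -/
def edges (x : Fin (m + 1) → W) : Fin m → W := fun j => x j.succ - x 0

omit [NormedSpace ℝ W] in
theorem continuous_edges : Continuous fun x : Fin (m + 1) → W => edges x := by
  unfold edges
  fun_prop

/-- The determinant of the edges of a tuple in `ℝᵐ`. -/
def edgeDet (u : Fin (m + 1) → Euc m) : ℝ := LinearMap.det (colMap (edges u)).toLinearMap

theorem continuous_edgeDet : Continuous fun u : Fin (m + 1) → Euc m => edgeDet u :=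
  (ContinuousLinearMap.continuous_det (𝕜 := ℝ) (E := Euc m)).comp
    (continuous_colMap.comp continuous_edges)

theorem edgeDet_add_const (u : Fin (m + 1) → Euc m) (c : Euc m) :
    edgeDet (fun i => u i + c) = edgeDet u := by
  have : edges (fun i => u i + c) = edges u := by
    funext j
    simp [edges]
  rw [edgeDet, this, edgeDet]

theorem edgeDet_linear (L : Euc m →ₗ[ℝ] Euc m) (u : Fin (m + 1) → Euc m) :
    edgeDet (fun i => L (u i)) = LinearMap.det L * edgeDet u := by
  unfold edgeDet
  rw [← LinearMap.det_comp]
  congr 1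
  ext1 v
  change colMap _ v = L (colMap _ v)
  have : edges (fun i => L (u i)) = fun j => L (edges u j) := by
    funext j
    simp [edges]
  rw [this, colMap_comp]

/-- Almost every `(m+1)`-tuple of points of `ℝᵐ` is affinely independent. -/
theorem ae_edgeDet_ne_zero : ∀ᵐ u : Fin (m + 1) → Euc m, edgeDet u ≠ 0 := by
  -- Moving `u` in this direction adds a multiple of the identity to the edge matrix, so the
  -- determinant becomes a monic characteristic polynomial in `t`, with finitely many roots.
  set e : Fin (m + 1) → Euc m := Fin.cons 0 fun j => EuclideanSpace.single j 1 with he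
  set Z : Set (Fin (m + 1) → Euc m) := {u | edgeDet u = 0} with hZ
  have hZm : MeasurableSet Z := (isClosed_singleton.preimage continuous_edgeDet).measurableSet
  have hline : ∀ u : Fin (m + 1) → Euc m, (volume {t : ℝ | u + t • e ∈ Z}) = 0 := by
    intro u
    have hfin : {t : ℝ | u + t • e ∈ Z} ⊆
        {t | ((-(colMap (edges u)).toLinearMap).charpoly).IsRoot t} := by
      intro t ht
      have h1 : edgeDet (u + t • e) = 0 := ht
      rw [Set.mem_ofPred_eq, Polynomial.IsRoot, LinearMap.eval_charpoly, ← h1, edgeDet]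
      congr 1
      refine (EuclideanSpace.basisFun (Fin m) ℝ).toBasis.ext fun j => ?_
      simp only [OrthonormalBasis.coe_toBasis, EuclideanSpace.basisFun_apply]
      change t • EuclideanSpace.single j (1 : ℝ) - -(colMap (edges u) (EuclideanSpace.single j 1))
        = colMap (edges (u + t • e)) (EuclideanSpace.single j 1)
      rw [colMap_single, colMap_single]
      simp only [edges, he, Pi.add_apply, Pi.smul_apply, Fin.cons_succ, Fin.cons_zero]
      module
    exact ((Polynomial.finite_setOfPred_isRoot (LinearMap.charpoly_monic _).ne_zero).subset
      hfin).measure_zero _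
  have hprod : (volume : Measure (ℝ × (Fin (m + 1) → Euc m)))
      {p | p.2 + p.1 • e ∈ Z} = 0 := by
    have hmeas : MeasurableSet {p : ℝ × (Fin (m + 1) → Euc m) | p.2 + p.1 • e ∈ Z} := by
      refine hZm.preimage (Continuous.measurable ?_)
      fun_prop
    rw [Measure.volume_eq_prod, Measure.prod_apply_symm hmeas]
    simp only [Set.preimage_ofPred_eq]
    simp_rw [hline]
    simp
  have hmeas : MeasurableSet {p : ℝ × (Fin (m + 1) → Euc m) | p.2 + p.1 • e ∈ Z} := by
    refine hZm.preimage (Continuous.measurable ?_)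
    fun_prop
  -- Slicing the same null set the other way: every slice at fixed `t` is a translate of `Z`, so an
  -- infinite multiple of `volume Z` vanishes.
  rw [Measure.volume_eq_prod, Measure.prod_apply hmeas] at hprod
  have hconst : ∀ t : ℝ, volume (Prod.mk t ⁻¹' {p : ℝ × (Fin (m + 1) → Euc m) |
      p.2 + p.1 • e ∈ Z}) = volume Z := by
    intro t
    exact measure_preimage_add_right volume (t • e) Z
  simp_rw [hconst] at hprod
  rw [lintegral_const] at hprod
  have : volume Z = 0 := by simpa using hprod
  rw [ae_iff]
  simpa [hZ] using this

end Columns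

/-! ### Volumes of simplices -/

/-- The vertices of the standard simplex of `ℝᵐ`. -/
def stdVertices (m : ℕ) : Fin (m + 1) → Euc m := Fin.cons 0 fun j => EuclideanSpace.single j 1

/-- The edge matrix followed by translation by `u 0` carries the standard simplex onto this one. It
lets `|edgeDet|` replace the volume throughout; the volume of the standard simplex cancels on
normalization. -/
theorem volume_convexHull_eq {m : ℕ} (u : Fin (m + 1) → Euc m) :
    volume (convexHull ℝ (Set.range u)) =
      ENNReal.ofReal |edgeDet u| * volume (convexHull ℝ (Set.range (stdVertices m))) := by
  set L := (colMap (edges u)).toLinearMap with hL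
  have hrange : Set.range u = (fun x => u 0 + x) '' (L '' Set.range (stdVertices m)) := by
    rw [← Set.range_comp, ← Set.range_comp]
    congr 1
    funext i
    refine Fin.cases ?_ (fun j => ?_) i
    · simp [stdVertices]
    · have : L (EuclideanSpace.single j 1) = edges u j := colMap_single _ j
      simp [stdVertices, this, edges]
  have h1 : convexHull ℝ (Set.range u) =
      (fun x => u 0 + x) '' (L '' convexHull ℝ (Set.range (stdVertices m))) := by
    rw [hrange, LinearMap.image_convexHull]
    have := (AffineEquiv.constVAdd ℝ (Euc m) (u 0)).toAffineMap.image_convexHull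
      (L '' Set.range (stdVertices m))
    exact this.symm
  rw [h1, Set.image_add_left, measure_preimage_add, Measure.addHaar_image_linearMap]
  rfl

theorem volume_stdSimplex_ne_top (m : ℕ) :
    volume (convexHull ℝ (Set.range (stdVertices m))) ≠ ∞ :=
  (((Set.finite_range _).isCompact_convexHull ℝ).measure_lt_top).ne

theorem volume_stdSimplex_ne_zero (m : ℕ) :
    volume (convexHull ℝ (Set.range (stdVertices m))) ≠ 0 := by
  intro h0
  have h : ∀ u : Fin (m + 1) → Euc m, volume (convexHull ℝ (Set.range u)) = 0 := by
    intro u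
    rw [volume_convexHull_eq, h0, mul_zero]
  have hspan : affineSpan ℝ (Set.range (stdVertices m)) = ⊤ := by
    refine (AffineSubspace.affineSpan_eq_top_iff_vectorSpan_eq_top_of_nonempty ℝ _ _
      (Set.range_nonempty _)).2 ?_
    rw [eq_top_iff, ← (EuclideanSpace.basisFun (Fin m) ℝ).toBasis.span_eq, Submodule.span_le]
    rintro _ ⟨j, rfl⟩
    have := vsub_mem_vectorSpan ℝ (Set.mem_range_self (f := stdVertices m) j.succ)
      (Set.mem_range_self 0)
    simpa [stdVertices] using this
  have hint := (interior_convexHull_nonempty_iff_affineSpan_eq_top).2 hspan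
  have := (isOpen_interior.measure_pos volume hint).trans_le (measure_mono interior_subset)
  rw [h0] at this
  exact lt_irrefl _ this

/-! ### Graph coordinates on tuples -/

theorem lintegral_fin_succ {n : ℕ} {E : Type*} [MeasureSpace E] [SigmaFinite (volume : Measure E)]
    (F : (Fin (n + 1) → E) → ℝ≥0∞) (hF : Measurable F) :
    ∫⁻ v, F v = ∫⁻ v₀ : E, ∫⁻ w : Fin n → E, F (Fin.cons v₀ w) := by
  have h := (volume_preserving_piFinSuccAbove (fun _ : Fin (n + 1) => E) 0).symm
  rw [← h.lintegral_comp_emb (MeasurableEquiv.measurableEmbedding _), Measure.volume_eq_prod,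
    lintegral_prod (fun z => F ((MeasurableEquiv.piFinSuccAbove (fun _ : Fin (n + 1) => E) 0).symm z))
      (hF.comp h.measurable).aemeasurable]
  simp_rw [MeasurableEquiv.piFinSuccAbove_symm_apply, Fin.insertNthEquiv]
  simp only [Fin.insertNth_zero, Equiv.coe_fn_mk]
  rfl

/-- Right composition of a linear map, given by its columns, with an endomorphism of `ℝᵐ`. -/
def precompColumns {m : ℕ} (q : ℕ) (L : Euc m →ₗ[ℝ] Euc m) :
    (Fin m → Euc q) →ₗ[ℝ] (Fin m → Euc q) where
  toFun a := fun j => colMap a (L (EuclideanSpace.single j 1))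
  map_add' a b := by
    funext j
    simp [colMap_apply, Finset.sum_add_distrib]
  map_smul' c a := by
    funext j
    simp only [colMap_apply, Pi.smul_apply, RingHom.id_apply, Finset.smul_sum]
    exact Finset.sum_congr rfl fun i _ => smul_comm _ _ _

/-- Read by rows instead of columns, a tuple is `q` vectors of ℝᵐ, and the transpose of the matrix
of `L` acts on each separately. -/
theorem det_precompColumns {m : ℕ} (q : ℕ) (L : Euc m →ₗ[ℝ] Euc m) :
    LinearMap.det (precompColumns q L) = LinearMap.det L ^ q := by
  set b := (EuclideanSpace.basisFun (Fin m) ℝ).toBasis with hb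
  set M : Matrix (Fin m) (Fin m) ℝ := LinearMap.toMatrix b b L with hM
  let e : (Fin m → Euc q) ≃ₗ[ℝ] (Fin q → (Fin m → ℝ)) :=
    { toFun := fun a c j => a j c
      invFun := fun r j => WithLp.toLp 2 fun c => r c j
      map_add' := fun a b => rfl
      map_smul' := fun c a => rfl
      left_inv := fun a => rfl
      right_inv := fun r => rfl }
  have hconj : (e : (Fin m → Euc q) →ₗ[ℝ] _) ∘ₗ precompColumns q L ∘ₗ e.symm.toLinearMap =
      LinearMap.pi fun i => (Matrix.toLin' M.transpose).comp (LinearMap.proj i) := by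
    refine LinearMap.ext fun r => ?_
    funext c j
    have hMij : ∀ i, M i j = L (EuclideanSpace.single j 1) i := by
      intro i
      rw [hM, LinearMap.toMatrix_apply]
      simp [hb]
    change (colMap (fun j => (WithLp.toLp 2 fun c => r c j : Euc q))
      (L (EuclideanSpace.single j 1))) c = (Matrix.toLin' M.transpose (r c)) j
    rw [Matrix.toLin'_apply, Matrix.mulVec, dotProduct, colMap_apply]
    simp [hMij]
  rw [← LinearMap.det_conj (precompColumns q L) e, hconj, LinearMap.det_pi]
  simp [hM, LinearMap.det_toMatrix]

/-- For affinely independent `u`, values at its points amount to an affine map `b + a`. The edges of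
`v` are the linear part composed with the edge matrix of `u`, which gives the power `q` of its
determinant. -/
theorem lintegral_eq_lintegral_affine {m q : ℕ} (u : Fin (m + 1) → Euc m) (hu : edgeDet u ≠ 0)
    (F : (Fin (m + 1) → Euc q) → ℝ≥0∞) (hF : Measurable F) :
    ∫⁻ v, F v = ENNReal.ofReal |edgeDet u| ^ q *
      ∫⁻ a : Fin m → Euc q, ∫⁻ b : Euc q, F (fun i => b + colMap a (u i)) := by
  have hdet : LinearMap.det (precompColumns q (colMap (edges u)).toLinearMap) ≠ 0 := by
    rw [det_precompColumns]
    exact pow_ne_zero _ hu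
  have hpt : ∀ (a : Fin m → Euc q) (v₀ : Euc q),
      (Fin.cons v₀ ((fun _ => v₀) + precompColumns q (colMap (edges u)).toLinearMap a) :
        Fin (m + 1) → Euc q) = fun i => (v₀ - colMap a (u 0)) + colMap a (u i) := by
    intro a v₀
    funext i
    refine Fin.cases ?_ (fun j => ?_) i
    · simp
    · have : precompColumns q (colMap (edges u)).toLinearMap a j = colMap a (edges u j) := by
        change colMap a (colMap (edges u) (EuclideanSpace.single j 1)) = _
        rw [colMap_single]
      simp only [Fin.cons_succ, Pi.add_apply, this, edges, map_sub]
      abel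
  have hmeas : Measurable fun p : Euc q × (Fin m → Euc q) =>
      F (fun i => (p.1 - colMap p.2 (u 0)) + colMap p.2 (u i)) := by
    refine hF.comp (Continuous.measurable ?_)
    simp only [colMap_apply]
    fun_prop
  have hinner : ∀ v₀ : Euc q, ∫⁻ w : Fin m → Euc q, F (Fin.cons v₀ w) =
      ENNReal.ofReal |edgeDet u| ^ q *
        ∫⁻ a : Fin m → Euc q, F (fun i => (v₀ - colMap a (u 0)) + colMap a (u i)) := by
    intro v₀
    rw [← lintegral_add_left_eq_self _ (fun _ => v₀ : Fin m → Euc q),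
      lintegral_comp_linearMap volume hdet, det_precompColumns, abs_pow,
      ENNReal.ofReal_pow (abs_nonneg _)]
    simp_rw [hpt]
    rfl
  rw [lintegral_fin_succ F hF]
  simp_rw [hinner]
  rw [lintegral_const_mul' _ _ (ENNReal.pow_ne_top ENNReal.ofReal_ne_top),
    lintegral_lintegral_swap hmeas.aemeasurable]
  congr 1
  refine lintegral_congr fun a => ?_
  exact lintegral_sub_right_eq_self (fun b => F fun i => b + colMap a (u i)) (colMap a (u 0))

/-! ### Affine graphs, their foot points and the Blaschke-Petkantschin formula -/

section Graph

variable {m q d : ℕ} (φ : WithLp 2 (Euc m × Euc q) ≃ₗᵢ[ℝ] Euc d)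

/-- The parametrization of the graph of the linear map with columns `a`. -/
def graphMap (a : Fin m → Euc q) : Euc m →ₗ[ℝ] Euc d :=
  φ.toLinearEquiv.toLinearMap ∘ₗ (WithLp.linearEquiv 2 ℝ (Euc m × Euc q)).symm.toLinearMap ∘ₗ
    (LinearMap.id.prod (colMap a).toLinearMap)

/-- The parametrization of the orthogonal complement of the graph of the linear map with columns
`a`. -/
def normalMap (a : Fin m → Euc q) : Euc q →ₗ[ℝ] Euc d :=
  φ.toLinearEquiv.toLinearMap ∘ₗ (WithLp.linearEquiv 2 ℝ (Euc m × Euc q)).symm.toLinearMap ∘ₗ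
    ((-(ContinuousLinearMap.adjoint (colMap a)).toLinearMap).prod LinearMap.id)

theorem graphMap_apply (a : Fin m → Euc q) (u : Euc m) :
    graphMap φ a u = φ (WithLp.toLp 2 (u, colMap a u)) := rfl

theorem normalMap_apply (a : Fin m → Euc q) (y : Euc q) :
    normalMap φ a y =
      φ (WithLp.toLp 2 (-(ContinuousLinearMap.adjoint (colMap a) y), y)) := rfl

theorem inner_graphMap_normalMap (a : Fin m → Euc q) (u : Euc m) (y : Euc q) :
    inner ℝ (graphMap φ a u) (normalMap φ a y) = 0 := by
  rw [graphMap_apply, normalMap_apply, LinearIsometryEquiv.inner_map_map,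
    WithLp.prod_inner_apply]
  simp [inner_neg_right, ContinuousLinearMap.adjoint_inner_right]

theorem graphMap_injective (a : Fin m → Euc q) : Function.Injective (graphMap φ a) := by
  intro u v h
  rw [graphMap_apply, graphMap_apply] at h
  have := WithLp.toLp_injective 2 (φ.injective h)
  exact (Prod.ext_iff.1 this).1

theorem normalMap_injective (a : Fin m → Euc q) : Function.Injective (normalMap φ a) := by
  intro u v h
  rw [normalMap_apply, normalMap_apply] at h
  have := WithLp.toLp_injective 2 (φ.injective h)
  exact (Prod.ext_iff.1 this).2

theorem continuous_graphMap (u : Euc m) : Continuous fun a => graphMap φ a u := by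
  simp only [graphMap_apply, colMap_apply]
  fun_prop

theorem continuous_adjoint_colMap :
    Continuous fun a : Fin m → Euc q => ContinuousLinearMap.adjoint (colMap a) :=
  (ContinuousLinearMap.adjoint (𝕜 := ℝ) (E := Euc m) (F := Euc q)).continuous.comp
    continuous_colMap

theorem continuous_normalMap (y : Euc q) : Continuous fun a => normalMap φ a y := by
  simp only [normalMap_apply]
  have : Continuous fun a : Fin m → Euc q => ContinuousLinearMap.adjoint (colMap a) y :=
    continuous_adjoint_colMap.clm_apply continuous_const
  fun_prop

/-- The change from the intercept of an affine graph to its foot point. -/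
def footMap (a : Fin m → Euc q) : Euc q →L[ℝ] Euc q :=
  ContinuousLinearMap.id ℝ _ + (colMap a).comp (ContinuousLinearMap.adjoint (colMap a))

theorem det_footMap_ne_zero (a : Fin m → Euc q) :
    LinearMap.det (footMap a).toLinearMap ≠ 0 := by
  intro h
  obtain ⟨y, hy, hy0⟩ := (Submodule.ne_bot_iff _).1 (LinearMap.bot_lt_ker_of_det_eq_zero h).ne'
  apply hy0
  have h1 : footMap a y = 0 := hy
  have h2 : inner ℝ y (footMap a y) = ‖y‖ ^ 2 + ‖ContinuousLinearMap.adjoint (colMap a) y‖ ^ 2 := by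
    simp [footMap, inner_add_right, ← ContinuousLinearMap.adjoint_inner_left]
  rw [h1, inner_zero_right] at h2
  have : ‖y‖ ^ 2 = 0 := by nlinarith [sq_nonneg ‖y‖, sq_nonneg ‖ContinuousLinearMap.adjoint (colMap a) y‖]
  simpa using this

theorem continuous_det_footMap :
    Continuous fun a : Fin m → Euc q => LinearMap.det (footMap a).toLinearMap := by
  refine (ContinuousLinearMap.continuous_det (𝕜 := ℝ) (E := Euc q)).comp ?_
  unfold footMap
  exact continuous_const.add (continuous_colMap.clm_comp continuous_adjoint_colMap)

/-- With `A` the linear map of columns `a`, the foot has the form `(-A* y, y)`; it lies on the graph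
of `b + A` exactly when `b = (1 + A A*) y`. So `footMap` recovers the intercept, and the positions
over ℝᵐ are shifted by `-A* y`. -/
theorem graphMap_add_normalMap (a : Fin m → Euc q) (u : Euc m) (y : Euc q) :
    graphMap φ a u + normalMap φ a y =
      φ (WithLp.toLp 2 (u - ContinuousLinearMap.adjoint (colMap a) y,
        footMap a y + colMap a (u - ContinuousLinearMap.adjoint (colMap a) y))) := by
  rw [graphMap_apply, normalMap_apply, ← map_add, ← WithLp.toLp_add]
  congr 2
  simp only [Prod.mk_add_mk, footMap, _root_.add_apply, map_sub,
    ContinuousLinearMap.coe_id', id_eq, ContinuousLinearMap.comp_apply, Prod.mk.injEq]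
  constructor <;> abel

/-- An affine Blaschke-Petkantschin formula, in graph coordinates. -/
theorem lintegral_tuple_eq (F : (Fin (m + 1) → Euc d) → ℝ≥0∞) (hF : Measurable F) :
    ∫⁻ x, F x = ∫⁻ a : Fin m → Euc q, ENNReal.ofReal |LinearMap.det (footMap a).toLinearMap| *
      ∫⁻ y : Euc q, ∫⁻ u : Fin (m + 1) → Euc m, ENNReal.ofReal |edgeDet u| ^ q *
        F (fun i => graphMap φ a (u i) + normalMap φ a y) := by
  have h1 : MeasurePreserving fun x : Fin (m + 1) → Euc m × Euc q =>
      fun i => φ (WithLp.toLp 2 (x i)) :=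
    volume_preserving_pi fun _ => φ.measurePreserving.comp (WithLp.volume_preserving_toLp _ _)
  have h2 := (volume_measurePreserving_arrowProdEquivProdArrow (Euc m) (Euc q) (Fin (m + 1))).symm
  have h3 := h1.comp h2
  have h4 : ∫⁻ x, F x = ∫⁻ u : Fin (m + 1) → Euc m, ∫⁻ v : Fin (m + 1) → Euc q,
      F fun i => φ (WithLp.toLp 2 (u i, v i)) := by
    rw [← h3.lintegral_comp hF, Measure.volume_eq_prod]
    exact lintegral_prod _ (hF.comp h3.measurable).aemeasurable
  have hFm : Measurable fun p : (Fin (m + 1) → Euc m) × (Fin (m + 1) → Euc q) =>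
      F fun i => φ (WithLp.toLp 2 (p.1 i, p.2 i)) := by
    refine hF.comp (Continuous.measurable ?_)
    fun_prop
  have h5 : ∀ᵐ u : Fin (m + 1) → Euc m, ∫⁻ v : Fin (m + 1) → Euc q,
      F (fun i => φ (WithLp.toLp 2 (u i, v i))) =
      ∫⁻ p : (Fin m → Euc q) × Euc q, ENNReal.ofReal |edgeDet u| ^ q *
        F (fun i => φ (WithLp.toLp 2 (u i, p.2 + colMap p.1 (u i)))) := by
    filter_upwards [ae_edgeDet_ne_zero] with u hu
    rw [lintegral_eq_lintegral_affine u hu (fun v => F fun i => φ (WithLp.toLp 2 (u i, v i)))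
      (hFm.comp measurable_prodMk_left),
      lintegral_const_mul' _ _ (ENNReal.pow_ne_top ENNReal.ofReal_ne_top), Measure.volume_eq_prod,
      lintegral_prod]
    refine Measurable.aemeasurable (hF.comp (Continuous.measurable ?_))
    simp only [colMap_apply]
    fun_prop
  have hG : Measurable fun r : (Fin (m + 1) → Euc m) × ((Fin m → Euc q) × Euc q) =>
      ENNReal.ofReal |edgeDet r.1| ^ q *
        F (fun i => φ (WithLp.toLp 2 (r.1 i, r.2.2 + colMap r.2.1 (r.1 i)))) := by
    refine Measurable.mul ?_ (hF.comp (Continuous.measurable ?_))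
    · exact ((continuous_edgeDet.measurable.comp measurable_fst).abs.ennreal_ofReal).pow_const _
    · simp only [colMap_apply]
      fun_prop
  rw [h4, lintegral_congr_ae h5, lintegral_lintegral_swap hG.aemeasurable, Measure.volume_eq_prod,
    lintegral_prod _ (hG.lintegral_prod_left').aemeasurable]
  refine lintegral_congr fun a => ?_
  -- The intercept is replaced by the foot parameter, and then all positions are translated
  -- together, which leaves `edgeDet` unchanged.
  rw [lintegral_comp_linearMap volume (det_footMap_ne_zero a)]
  congr 1
  refine lintegral_congr fun y => ?_
  simp_rw [graphMap_add_normalMap]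
  rw [← lintegral_sub_right_eq_self _
    (fun _ => ContinuousLinearMap.adjoint (colMap a) y : Fin (m + 1) → Euc m)]
  refine lintegral_congr fun u => ?_
  have h6 : edgeDet (u - fun _ => ContinuousLinearMap.adjoint (colMap a) y) = edgeDet u := by
    rw [← edgeDet_add_const u (-(ContinuousLinearMap.adjoint (colMap a) y))]
    simp only [sub_eq_add_neg]
    rfl
  rw [h6]
  rfl

end Graph

/-! ### Foot points and orthogonal complements -/

section Flats

variable {d ℓ : ℕ}

theorem AffGr.foot_mem_direction_orthogonal (E : AffGr d ℓ) :
    (E.foot : Euc d) ∈ E.1.directionᗮ := by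
  have : Nonempty E.1 := E.2.1.to_subtype
  have h := EuclideanGeometry.orthogonalProjection_vsub_mem_direction_orthogonal E.1 (0 : Euc d)
  rw [vsub_eq_sub, sub_zero] at h
  exact h

theorem AffGr.foot_eq_of_mem (E : AffGr d ℓ) {p : Euc d} (hp : p ∈ E.1)
    (hp' : p ∈ E.1.directionᗮ) : (E.foot : Euc d) = p := by
  have h1 : (E.foot : Euc d) - p ∈ E.1.direction := E.1.vsub_mem_direction E.foot.2 hp
  have h2 : (E.foot : Euc d) - p ∈ E.1.directionᗮ :=
    Submodule.sub_mem _ E.foot_mem_direction_orthogonal hp'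
  exact sub_eq_zero.1 (Submodule.disjoint_def.1 E.1.direction.orthogonal_disjoint _ h1 h2)

theorem AffGr.foot_eq_sub (E : AffGr d ℓ) {p : Euc d} (hp : p ∈ E.1) :
    (E.foot : Euc d) = p - E.1.direction.starProjection p := by
  apply E.foot_eq_of_mem
  · have := AffineSubspace.vadd_mem_of_mem_direction
      (E.1.direction.neg_mem (E.1.direction.starProjection_apply_mem p)) hp
    rwa [vadd_eq_add, neg_add_eq_sub] at this
  · exact Submodule.sub_starProjection_mem_orthogonal p

theorem AffGr.proj_of_mem (E : AffGr d ℓ) {p : Euc d} (hp : p ∈ E.1) : E.proj p = ⟨p, hp⟩ := by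
  have : Nonempty E.1 := E.2.1.to_subtype
  exact Subtype.ext (EuclideanGeometry.orthogonalProjection_eq_self_iff.2 hp)

theorem continuous_starProjection_foot : Continuous fun E : AffGr d ℓ =>
    ((E.1.direction.starProjection, (E.foot : Euc d)) : (Euc d →L[ℝ] Euc d) × Euc d) :=
  continuous_induced_dom

theorem continuous_direction_starProjection :
    Continuous fun E : AffGr d ℓ => E.1.direction.starProjection :=
  continuous_starProjection_foot.fst

theorem continuous_foot : Continuous fun E : AffGr d ℓ => (E.foot : Euc d) :=
  continuous_starProjection_foot.snd

theorem continuous_dist : Continuous fun E : AffGr d ℓ => E.dist :=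
  continuous_foot.norm

/-- The linear subspace orthogonal to the direction of a flat. -/
def perpGr {m q d : ℕ} (h : m + q = d) (E : AffGr d m) : AffGr d q :=
  ⟨(E.1.directionᗮ).toAffineSubspace, ⟨0, E.1.directionᗮ.zero_mem⟩, by
    have h := Submodule.finrank_add_finrank_orthogonal E.1.direction
    rw [E.2.2, finrank_euclideanSpace_fin] at h
    rw [Submodule.toAffineSubspace_direction]
    omega⟩

variable {m q : ℕ} (hmq : m + q = d)

theorem perpGr_foot (E : AffGr d m) : ((perpGr hmq E).foot : Euc d) = 0 :=
  AffGr.foot_eq_of_mem _ (E.1.directionᗮ.zero_mem) (Submodule.zero_mem _)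

theorem direction_perpGr (E : AffGr d m) : (perpGr hmq E).1.direction = E.1.directionᗮ :=
  Submodule.toAffineSubspace_direction _

theorem perpGr_congr {E F : AffGr d m} (h : E.1.direction = F.1.direction) :
    perpGr hmq E = perpGr hmq F := by
  apply Subtype.ext
  change (E.1.directionᗮ).toAffineSubspace = (F.1.directionᗮ).toAffineSubspace
  rw [h]

theorem continuous_perpGr : Continuous (perpGr hmq) := by
  refine continuous_induced_rng.2 (Continuous.prodMk ?_ ?_)
  · have : ∀ E : AffGr d m, (perpGr hmq E).1.direction.starProjection =
        ContinuousLinearMap.id ℝ _ - E.1.direction.starProjection := by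
      intro E
      rw [← Submodule.starProjection_orthogonal]
      congr 1
      exact direction_perpGr hmq E
    simp_rw [this]
    exact continuous_const.sub continuous_direction_starProjection
  · simp_rw [perpGr_foot]
    exact continuous_const

/-- An isometric identification of a flat is linear in any linear coordinate based at the foot. -/
theorem IsometrySystem.exists_linear (I : IsometrySystem d ℓ) (E : AffGr d ℓ)
    (H : Euc ℓ →ₗ[ℝ] Euc d) (hH : ∀ u, H u ∈ E.1.direction) :
    ∃ Ψ : Euc ℓ →ₗ[ℝ] Euc ℓ, (∀ u, I.toFun E (E.proj (H u + E.foot)) = Ψ u) ∧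
      (∀ u, ‖Ψ u‖ = ‖H u‖) ∧ |LinearMap.det Ψ| = H.normDet := by
  have : Nonempty E.1 := E.2.1.to_subtype
  -- An isometry into a strictly convex space is affine, even before surjectivity is known.
  set f := (I.isometry E).affineIsometryOfStrictConvexSpace with hf
  set K : Euc ℓ →ₗ[ℝ] E.1.direction := H.codRestrict _ hH with hK
  refine ⟨f.linearIsometry.toLinearMap ∘ₗ K, fun u => ?_, fun u => ?_, ?_⟩
  · have hmem : H u + (E.foot : Euc d) ∈ E.1 :=
      AffineSubspace.vadd_mem_of_mem_direction (hH u) E.foot.2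
    rw [E.proj_of_mem hmem]
    have h1 : (⟨H u + (E.foot : Euc d), hmem⟩ : E.1) = K u +ᵥ E.foot := rfl
    have h2 : f (K u +ᵥ E.foot) = f.linearIsometry (K u) +ᵥ f E.foot := f.map_vadd _ _
    have h3 : f E.foot = 0 := I.map_foot E
    rw [h3, vadd_eq_add, add_zero] at h2
    rw [h1]
    exact h2
  · change ‖f.linearIsometry (K u)‖ = _
    rw [LinearIsometry.norm_map]
    rfl
  · rw [← LinearMap.normDet_eq_abs_det, LinearMap.normDet_comp_of_finrank_eq,
      LinearIsometry.normDet_eq_one, one_mul, hK, LinearMap.normDet_codRestrict]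
    rw [E.2.2, finrank_euclideanSpace_fin]

end Flats

/-! ### The affine hull of a tuple -/

section Hull

variable {m d : ℕ}

theorem direction_affineSpan_range (x : Fin (m + 1) → Euc d) :
    (affineSpan ℝ (Set.range x)).direction = LinearMap.range (colMap (edges x)).toLinearMap := by
  rw [direction_affineSpan, vectorSpan_range_eq_span_range_vsub_right ℝ x 0, range_colMap]
  apply le_antisymm
  · rw [Submodule.span_le]
    rintro _ ⟨i, rfl⟩
    refine Fin.cases ?_ (fun j => ?_) i
    · simp
    · exact Submodule.subset_span ⟨j, rfl⟩
  · rw [Submodule.span_le]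
    rintro _ ⟨j, rfl⟩
    exact Submodule.subset_span ⟨j.succ, rfl⟩

/-- The tuples whose affine hull has the maximal dimension. -/
def genericSet (m d : ℕ) : Set (Fin (m + 1) → Euc d) :=
  {x | Module.finrank ℝ (affineSpan ℝ (Set.range x)).direction = m}

theorem mem_genericSet_iff_linearIndependent (x : Fin (m + 1) → Euc d) :
    x ∈ genericSet m d ↔ LinearIndependent ℝ (edges x) := by
  rw [linearIndependent_iff_card_eq_finrank_span, genericSet, Set.mem_ofPred_eq,
    direction_affineSpan_range, range_colMap, Fintype.card_fin, eq_comm]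
  rfl

theorem mem_genericSet_iff_injective (x : Fin (m + 1) → Euc d) :
    x ∈ genericSet m d ↔ Function.Injective (colMap (edges x)) := by
  have h := LinearMap.finrank_range_add_finrank_ker (colMap (edges x)).toLinearMap
  rw [finrank_euclideanSpace_fin] at h
  rw [genericSet, Set.mem_ofPred_eq, direction_affineSpan_range]
  rw [← ContinuousLinearMap.coe_coe, ← LinearMap.ker_eq_bot, ← Submodule.finrank_eq_zero (R := ℝ)]
  omega

theorem isOpen_genericSet (m d : ℕ) : IsOpen (genericSet m d) := by
  have : genericSet m d = edges ⁻¹' {f | LinearIndependent ℝ f} := by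
    ext x
    exact mem_genericSet_iff_linearIndependent x
  rw [this]
  exact isOpen_setOfPred_linearIndependent.preimage continuous_edges

theorem isUnit_adjoint_comp_self {D : Euc m →L[ℝ] Euc d} (hD : Function.Injective D) :
    IsUnit ((ContinuousLinearMap.adjoint D).comp D) := by
  rw [ContinuousLinearMap.isUnit_iff_bijective]
  have hinj : Function.Injective ((ContinuousLinearMap.adjoint D).comp D) := by
    rw [injective_iff_map_eq_zero]
    intro u hu
    have h1 : inner ℝ u ((ContinuousLinearMap.adjoint D).comp D u) = ‖D u‖ ^ 2 := by
      rw [ContinuousLinearMap.comp_apply, ContinuousLinearMap.adjoint_inner_right,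
        real_inner_self_eq_norm_sq]
    rw [hu, inner_zero_right] at h1
    have h2 : D u = 0 := by simpa using h1.symm
    exact hD (h2.trans (map_zero D).symm)
  exact ⟨hinj, (LinearMap.injective_iff_surjective
    (f := ((ContinuousLinearMap.adjoint D).comp D).toLinearMap)).1 hinj⟩

/-- These are the normal equations of least squares. The formula shows that the projection depends
continuously on `D`, since inversion is continuous at units; this is what makes the affine hull a
continuous function of a generic tuple. -/
theorem starProjection_range_eq {D : Euc m →L[ℝ] Euc d} (hD : Function.Injective D) :
    (LinearMap.range D.toLinearMap).starProjection =
      D.comp ((Ring.inverse ((ContinuousLinearMap.adjoint D).comp D)).comp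
        (ContinuousLinearMap.adjoint D)) := by
  ext1 v
  refine Submodule.eq_starProjection_of_mem_orthogonal (LinearMap.mem_range_self D.toLinearMap _) ?_
  rintro _ ⟨u, rfl⟩
  have h1 := Ring.mul_inverse_cancel _ (isUnit_adjoint_comp_self hD)
  have h2 := DFunLike.congr_fun h1 (ContinuousLinearMap.adjoint D v)
  change inner ℝ (D u) _ = 0
  rw [← ContinuousLinearMap.adjoint_inner_right, map_sub]
  have h3 : ContinuousLinearMap.adjoint D (D (Ring.inverse ((ContinuousLinearMap.adjoint D).comp D)
    (ContinuousLinearMap.adjoint D v))) = ContinuousLinearMap.adjoint D v := h2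
  rw [ContinuousLinearMap.comp_apply, ContinuousLinearMap.comp_apply, h3, sub_self,
    inner_zero_right]

/-- The affine hull of a generic tuple. -/
def genericHull (x : genericSet m d) : AffGr d m :=
  ⟨affineSpan ℝ (Set.range x.1), ⟨x.1 0, mem_affineSpan ℝ ⟨_, rfl⟩⟩, x.2⟩

theorem continuous_genericHull : Continuous (genericHull : genericSet m d → AffGr d m) := by
  have hproj : Continuous fun x : genericSet m d =>
      (genericHull x).1.direction.starProjection := by
    have h : ∀ x : genericSet m d, (genericHull x).1.direction.starProjection =
        (colMap (edges x.1)).comp ((Ring.inverse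
          ((ContinuousLinearMap.adjoint (colMap (edges x.1))).comp (colMap (edges x.1)))).comp
        (ContinuousLinearMap.adjoint (colMap (edges x.1)))) := by
      intro x
      rw [← starProjection_range_eq ((mem_genericSet_iff_injective x.1).1 x.2)]
      congr 1
      exact direction_affineSpan_range x.1
    simp_rw [h]
    have hD : Continuous fun x : genericSet m d => colMap (edges x.1) :=
      continuous_colMap.comp (continuous_edges.comp continuous_subtype_val)
    have hA : Continuous fun x : genericSet m d =>
        ContinuousLinearMap.adjoint (colMap (edges x.1)) :=
      (ContinuousLinearMap.adjoint (𝕜 := ℝ) (E := Euc m) (F := Euc d)).continuous.comp hD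
    refine hD.clm_comp (Continuous.clm_comp ?_ hA)
    rw [continuous_iff_continuousAt]
    intro x
    obtain ⟨w, hw⟩ := isUnit_adjoint_comp_self ((mem_genericSet_iff_injective x.1).1 x.2)
    have hinv := NormedRing.inverse_continuousAt w
    rw [hw] at hinv
    exact hinv.comp_of_eq (hA.clm_comp hD).continuousAt rfl
  refine continuous_induced_rng.2 (hproj.prodMk ?_)
  have hfoot : ∀ x : genericSet m d, ((genericHull x).foot : Euc d) =
      x.1 0 - (genericHull x).1.direction.starProjection (x.1 0) := fun x =>
    (genericHull x).foot_eq_sub (mem_affineSpan ℝ ⟨0, rfl⟩)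
  simp_rw [hfoot]
  have h0 : Continuous fun x : genericSet m d => x.1 0 :=
    (continuous_apply 0).comp continuous_subtype_val
  exact h0.sub (hproj.clm_apply h0)

open Classical in
/-- The affine hull of a generic tuple, extended to all tuples by a constant. -/
def hullGr (E₀ : AffGr d m) (x : Fin (m + 1) → Euc d) : AffGr d m :=
  if h : x ∈ genericSet m d then genericHull ⟨x, h⟩ else E₀

theorem hullGr_of_mem (E₀ : AffGr d m) {x : Fin (m + 1) → Euc d} (h : x ∈ genericSet m d) :
    hullGr E₀ x = genericHull ⟨x, h⟩ := dif_pos h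

theorem measurable_hullGr (E₀ : AffGr d m) : Measurable (hullGr E₀) := by
  classical
  refine measurable_of_restrict_of_restrict_compl (isOpen_genericSet m d).measurableSet ?_ ?_
  · have : (genericSet m d).domRestrict (hullGr E₀) = genericHull := by
      funext x
      exact hullGr_of_mem E₀ x.2
    rw [this]
    exact continuous_genericHull.measurable
  · have : (genericSet m d)ᶜ.domRestrict (hullGr E₀) = fun _ => E₀ := by
      funext x
      exact dif_neg x.2
    rw [this]
    exact measurable_const

end Hull

/-! ### Canonical coordinates of a tuple -/

section Coordinates

variable {m q d : ℕ} (hmq : m + q = d) (I : IsometrySystem d m) (J : IsometrySystem d q)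
  (E₀ : AffGr d m)

/-- The coordinates of the points of a tuple within its affine hull, rescaled by
`√(dist² + σ)`. -/
def innerCoord (σ : ℝ) (x : Fin (m + 1) → Euc d) : Fin (m + 1) → Euc m := fun i =>
  (Real.sqrt ((hullGr E₀ x).dist ^ 2 + σ))⁻¹ •
    I.toFun (hullGr E₀ x) ((hullGr E₀ x).proj (x i))

/-- The coordinates of the foot of the affine hull of a tuple. -/
def footCoord (x : Fin (m + 1) → Euc d) : Euc q :=
  J.toFun (perpGr hmq (hullGr E₀ x))
    ((perpGr hmq (hullGr E₀ x)).proj (hullGr E₀ x).foot)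

theorem measurable_innerCoord (σ : ℝ) : Measurable (innerCoord I E₀ σ) := by
  refine measurable_pi_lambda _ fun i => ?_
  have h1 : Measurable fun x => (Real.sqrt ((hullGr E₀ x).dist ^ 2 + σ))⁻¹ :=
    (((continuous_dist.measurable.comp (measurable_hullGr E₀)).pow_const 2).add_const σ).sqrt.inv
  have h2 : Measurable fun x : Fin (m + 1) → Euc d =>
      I.toFun (hullGr E₀ x) ((hullGr E₀ x).proj (x i)) :=
    I.measurable.comp ((measurable_pi_apply i).prodMk (measurable_hullGr E₀))
  exact h1.smul h2

theorem measurable_footCoord : Measurable (footCoord hmq J E₀) :=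
  J.measurable.comp ((continuous_foot.measurable.comp (measurable_hullGr E₀)).prodMk
    ((continuous_perpGr hmq).measurable.comp (measurable_hullGr E₀)))

end Coordinates

/-! ### The decomposition formula -/

/-- The radial weight `(‖x‖² + σ)^(-β)`. -/
def radialWeight {n : ℕ} (σ β : ℝ) (x : Euc n) : ℝ≥0∞ := ENNReal.ofReal ((‖x‖ ^ 2 + σ) ^ (-β))

theorem measurable_radialWeight {n : ℕ} (σ β : ℝ) :
    Measurable (radialWeight σ β : Euc n → ℝ≥0∞) := by
  unfold radialWeight
  exact (((measurable_norm.pow_const 2).add_const σ).pow_const (-β)).ennreal_ofReal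

/-- The points at which the radial weight is meaningful. -/
def radialSet (n : ℕ) (σ : ℝ) : Set (Euc n) := {x | 0 < ‖x‖ ^ 2 + σ}

theorem measurableSet_radialSet (n : ℕ) (σ : ℝ) : MeasurableSet (radialSet n σ) :=
  measurableSet_lt measurable_const ((measurable_norm.pow_const 2).add_const σ)

/-- The unnormalized weight of the simplex with the given vertices. -/
def vertexWeight (m q : ℕ) (β : ℝ) (z : Fin (m + 1) → Euc m) : ℝ≥0∞ :=
  ENNReal.ofReal |edgeDet z| ^ q * ∏ i, radialWeight 1 β (z i)

theorem measurable_vertexWeight (m q : ℕ) (β : ℝ) : Measurable (vertexWeight m q β) := by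
  unfold vertexWeight
  refine Measurable.mul ?_ ?_
  · exact continuous_edgeDet.measurable.abs.ennreal_ofReal.pow_const _
  · exact Finset.measurable_prod _ fun i _ =>
      (measurable_radialWeight 1 β).comp (measurable_pi_apply i)

/-- The generic tuples whose affine hull lies in the domain of the radial weight. -/
def flatSet {m d : ℕ} (E₀ : AffGr d m) (σ : ℝ) : Set (Fin (m + 1) → Euc d) :=
  {x | x ∈ genericSet m d ∧ 0 < (hullGr E₀ x).dist ^ 2 + σ}

theorem measurableSet_flatSet {m d : ℕ} (E₀ : AffGr d m) (σ : ℝ) :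
    MeasurableSet (flatSet E₀ σ) := by
  have h : MeasurableSet {x | 0 < (hullGr E₀ x).dist ^ 2 + σ} :=
    measurableSet_lt measurable_const
      (((continuous_dist.measurable.comp (measurable_hullGr E₀)).pow_const 2).add_const σ)
  exact (isOpen_genericSet m d).measurableSet.inter h

/-! ### Separation of shape and foot in canonical coordinates -/

section Graph

variable {m q d : ℕ} (φ : WithLp 2 (Euc m × Euc q) ≃ₗᵢ[ℝ] Euc d)

theorem normDet_pos_of_injective {n : ℕ} {H : Euc n →ₗ[ℝ] Euc d} (hH : Function.Injective H) :
    0 < H.normDet := by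
  refine lt_of_le_of_ne H.normDet_nonneg (Ne.symm ?_)
  rw [Ne, LinearMap.normDet_eq_zero_iff_ker_ne_bot, not_not]
  exact LinearMap.ker_eq_bot.2 hH

/-- `normDet` is the square root of the Gram determinant of the images of an orthonormal basis,
hence even continuous in `a`. -/
theorem measurable_normDet {A : Type*} [TopologicalSpace A] [MeasurableSpace A]
    [OpensMeasurableSpace A] {n : ℕ} {H : A → Euc n →ₗ[ℝ] Euc d}
    (hH : ∀ u, Continuous fun a => H a u) : Measurable fun a => (H a).normDet := by
  have h : ∀ a, (H a).normDet = Real.sqrt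
      (Matrix.gram ℝ fun i => H a (EuclideanSpace.basisFun (Fin n) ℝ i)).det := by
    intro a
    have := LinearMap.normDet_sq_eq_det_gram (H a) (EuclideanSpace.basisFun (Fin n) ℝ)
    rw [← this]
    exact (Real.sqrt_sq (H a).normDet_nonneg).symm
  simp_rw [h]
  refine Continuous.measurable (Real.continuous_sqrt.comp (Continuous.matrix_det ?_))
  refine continuous_matrix fun i j => ?_
  simp only [Matrix.gram_apply]
  exact (hH _).inner (hH _)

/-- The Jacobian of the graph coordinates, relative to canonical coordinates. -/
def graphJacobian (a : Fin m → Euc q) : ℝ≥0∞ :=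
  ENNReal.ofReal |LinearMap.det (footMap a).toLinearMap| *
    (ENNReal.ofReal (((graphMap φ a).normDet)⁻¹ ^ (m + 1 + q)) *
      ENNReal.ofReal ((normalMap φ a).normDet)⁻¹)

theorem measurable_graphJacobian : Measurable (graphJacobian φ) := by
  unfold graphJacobian
  have h1 := measurable_normDet (continuous_graphMap φ)
  have h2 := measurable_normDet (continuous_normalMap φ)
  exact continuous_det_footMap.measurable.abs.ennreal_ofReal.mul
    (((h1.inv).pow_const _).ennreal_ofReal.mul h2.inv.ennreal_ofReal)

theorem norm_graphMap_add_normalMap_sq (a : Fin m → Euc q) (u : Euc m) (y : Euc q) :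
    ‖graphMap φ a u + normalMap φ a y‖ ^ 2 = ‖graphMap φ a u‖ ^ 2 + ‖normalMap φ a y‖ ^ 2 := by
  have := norm_add_sq_eq_norm_sq_add_norm_sq_of_inner_eq_zero _ _
    (inner_graphMap_normalMap φ a u y)
  simpa [sq] using this

/-- The flat with foot `normalMap φ a y` parallel to the graph of `a`. -/
def graphFlat (a : Fin m → Euc q) (y : Euc q) : AffGr d m :=
  ⟨AffineSubspace.mk' (normalMap φ a y) (LinearMap.range (graphMap φ a)),
    ⟨_, AffineSubspace.self_mem_mk' _ _⟩, by
      rw [AffineSubspace.direction_mk',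
        LinearMap.finrank_range_of_inj (graphMap_injective φ a), finrank_euclideanSpace_fin]⟩

theorem direction_graphFlat (a : Fin m → Euc q) (y : Euc q) :
    (graphFlat φ a y).1.direction = LinearMap.range (graphMap φ a) :=
  AffineSubspace.direction_mk' _ _

theorem normalMap_mem_direction_orthogonal (a : Fin m → Euc q) (y y' : Euc q) :
    normalMap φ a y ∈ (graphFlat φ a y').1.directionᗮ := by
  rw [direction_graphFlat]
  rintro _ ⟨u, rfl⟩
  exact inner_graphMap_normalMap φ a u y

theorem foot_graphFlat (a : Fin m → Euc q) (y : Euc q) :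
    ((graphFlat φ a y).foot : Euc d) = normalMap φ a y :=
  AffGr.foot_eq_of_mem _ (AffineSubspace.self_mem_mk' _ _)
    (normalMap_mem_direction_orthogonal φ a y y)

theorem edges_graph (a : Fin m → Euc q) (y : Euc q) (u : Fin (m + 1) → Euc m) :
    edges (fun i => graphMap φ a (u i) + normalMap φ a y) =
      fun j => graphMap φ a (edges u j) := by
  funext j
  simp [edges]

theorem bijective_colMap_of_edgeDet {u : Fin (m + 1) → Euc m} (hu : edgeDet u ≠ 0) :
    Function.Bijective (colMap (edges u)) :=
  (LinearMap.equivOfDetNeZero (colMap (edges u)).toLinearMap hu).bijective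

theorem graph_mem_genericSet (a : Fin m → Euc q) (y : Euc q) {u : Fin (m + 1) → Euc m}
    (hu : edgeDet u ≠ 0) :
    (fun i => graphMap φ a (u i) + normalMap φ a y) ∈ genericSet m d := by
  rw [mem_genericSet_iff_injective, edges_graph]
  intro v w h
  rw [colMap_comp, colMap_comp] at h
  exact (bijective_colMap_of_edgeDet hu).1 (graphMap_injective φ a h)

theorem hullGr_graph (E₀ : AffGr d m) (a : Fin m → Euc q) (y : Euc q) {u : Fin (m + 1) → Euc m}
    (hu : edgeDet u ≠ 0) :
    hullGr E₀ (fun i => graphMap φ a (u i) + normalMap φ a y) = graphFlat φ a y := by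
  rw [hullGr_of_mem E₀ (graph_mem_genericSet φ a y hu)]
  apply Subtype.ext
  have hmem : graphMap φ a (u 0) + normalMap φ a y ∈ (graphFlat φ a y).1 := by
    refine (AffineSubspace.mem_mk').2 ?_
    exact ⟨u 0, by simp⟩
  refine AffineSubspace.ext_of_direction_eq ?_
    ⟨graphMap φ a (u 0) + normalMap φ a y, mem_affineSpan ℝ ⟨0, rfl⟩, hmem⟩
  rw [direction_graphFlat]
  change (affineSpan ℝ (Set.range _)).direction = _
  rw [direction_affineSpan_range, edges_graph]
  ext v
  constructor
  · rintro ⟨w, rfl⟩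
    exact ⟨colMap (edges u) w, (colMap_comp _ _ _).symm⟩
  · rintro ⟨w, rfl⟩
    obtain ⟨w, rfl⟩ := (bijective_colMap_of_edgeDet hu).2 w
    exact ⟨w, colMap_comp _ _ _⟩

variable (hmq : m + q = d) (I : IsometrySystem d m) (J : IsometrySystem d q) (E₀ : AffGr d m)

theorem exists_linear_innerCoord (a : Fin m → Euc q) (y : Euc q) :
    ∃ Ψ : Euc m →ₗ[ℝ] Euc m, (∀ u, ‖Ψ u‖ = ‖graphMap φ a u‖) ∧
      |LinearMap.det Ψ| = (graphMap φ a).normDet ∧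
      ∀ (σ : ℝ) (u : Fin (m + 1) → Euc m), edgeDet u ≠ 0 →
        innerCoord I E₀ σ (fun i => graphMap φ a (u i) + normalMap φ a y) =
          fun i => (Real.sqrt (‖normalMap φ a y‖ ^ 2 + σ))⁻¹ • Ψ (u i) := by
  obtain ⟨Ψ, h1, h2, h3⟩ := I.exists_linear (graphFlat φ a y) (graphMap φ a) (fun u => by
    rw [direction_graphFlat]
    exact ⟨u, rfl⟩)
  refine ⟨Ψ, h2, h3, fun σ u hu => ?_⟩
  funext i
  unfold innerCoord
  rw [hullGr_graph φ E₀ a y hu, ← h1, foot_graphFlat, AffGr.dist, foot_graphFlat]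

theorem exists_linear_footCoord (a : Fin m → Euc q) :
    ∃ Ω : Euc q →ₗ[ℝ] Euc q, (∀ y, ‖Ω y‖ = ‖normalMap φ a y‖) ∧
      |LinearMap.det Ω| = (normalMap φ a).normDet ∧
      ∀ (y : Euc q) (u : Fin (m + 1) → Euc m), edgeDet u ≠ 0 →
        footCoord hmq J E₀ (fun i => graphMap φ a (u i) + normalMap φ a y) = Ω y := by
  obtain ⟨Ω, h1, h2, h3⟩ := J.exists_linear (perpGr hmq (graphFlat φ a 0)) (normalMap φ a)
    (fun y => by
      rw [direction_perpGr]
      exact normalMap_mem_direction_orthogonal φ a y 0)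
  refine ⟨Ω, h2, h3, fun y u hu => ?_⟩
  unfold footCoord
  -- The orthogonal complement sees only the direction, so one linear map `Ω` serves all `y`; `y`
  -- can then be substituted with `a` fixed.
  have hdir : perpGr hmq (graphFlat φ a y) = perpGr hmq (graphFlat φ a 0) :=
    perpGr_congr hmq (by rw [direction_graphFlat, direction_graphFlat])
  rw [hullGr_graph φ E₀ a y hu, foot_graphFlat, hdir, ← h1, perpGr_foot, add_zero]

/-- Pythagoras: with `s = ‖normalMap φ a y‖² + σ`, the squared norm plus `σ` is `s + ‖Ψ u‖² = s (1 +
‖Ψ u / √s‖²)`. Whatever the sign of `σ`, the in-flat weight has shift 1. -/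
theorem radialWeight_graph {a : Fin m → Euc q} {y : Euc q} {Ψ : Euc m →ₗ[ℝ] Euc m}
    (hΨ : ∀ u, ‖Ψ u‖ = ‖graphMap φ a u‖) {σ : ℝ} (hs : 0 < ‖normalMap φ a y‖ ^ 2 + σ) (β : ℝ)
    (u : Euc m) :
    radialWeight σ β (graphMap φ a u + normalMap φ a y) =
      ENNReal.ofReal ((‖normalMap φ a y‖ ^ 2 + σ) ^ (-β)) *
        radialWeight 1 β (((Real.sqrt (‖normalMap φ a y‖ ^ 2 + σ))⁻¹ • Ψ) u) := by
  unfold radialWeight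
  rw [← ENNReal.ofReal_mul (Real.rpow_nonneg hs.le _), ← Real.mul_rpow hs.le (by positivity)]
  congr 2
  rw [norm_graphMap_add_normalMap_sq, LinearMap.smul_apply, norm_smul, hΨ, norm_inv,
    Real.norm_of_nonneg (Real.sqrt_nonneg _), mul_pow, inv_pow, Real.sq_sqrt hs.le]
  field_simp
  ring

/-- Here `√s⁻¹ ^ m * δ` is the determinant of the rescaled in-flat map. It enters with exponent `m +
1` from substituting every vertex and `q` from `|edgeDet| ^ q`. -/
theorem jacobian_power {s δ β : ℝ} (hs : 0 < s) (m q : ℕ) :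
    (s ^ (-β)) ^ (m + 1) * (((Real.sqrt s)⁻¹ ^ m * δ)⁻¹) ^ (m + 1 + q) =
      δ⁻¹ ^ (m + 1 + q) * s ^ (-((m + 1 : ℝ) * β - (m : ℝ) * (m + 1 + q) / 2)) := by
  rw [mul_inv, inv_pow, inv_inv, mul_pow, ← mul_assoc, mul_comm]
  congr 1
  rw [Real.sqrt_eq_rpow, ← Real.rpow_natCast, ← Real.rpow_natCast, ← Real.rpow_natCast,
    ← Real.rpow_mul hs.le, ← Real.rpow_mul hs.le, ← Real.rpow_mul hs.le, ← Real.rpow_add hs]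
  congr 1
  push_cast
  ring

theorem lintegral_graph_inner (β : ℝ) {σ : ℝ} {a : Fin m → Euc q} {y : Euc q}
    (hs : 0 < ‖normalMap φ a y‖ ^ 2 + σ)
    (g : (Fin (m + 1) → Euc m) × Euc q → ℝ≥0∞) (w : Euc q)
    {Ψ : Euc m →ₗ[ℝ] Euc m} (hΨ : ∀ u, ‖Ψ u‖ = ‖graphMap φ a u‖)
    (hdet : |LinearMap.det Ψ| = (graphMap φ a).normDet) :
    ∫⁻ u : Fin (m + 1) → Euc m, ENNReal.ofReal |edgeDet u| ^ q *
      (g (fun i => (Real.sqrt (‖normalMap φ a y‖ ^ 2 + σ))⁻¹ • Ψ (u i), w) *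
        ∏ i, radialWeight σ β (graphMap φ a (u i) + normalMap φ a y)) =
    ENNReal.ofReal ((graphMap φ a).normDet⁻¹ ^ (m + 1 + q)) *
      (ENNReal.ofReal ((‖normalMap φ a y‖ ^ 2 + σ) ^
        (-((m + 1 : ℝ) * β - (m : ℝ) * (m + 1 + q) / 2))) *
      ∫⁻ z, g (z, w) * vertexWeight m q β z) := by
  set s := ‖normalMap φ a y‖ ^ 2 + σ with hs_def
  set L : Euc m →ₗ[ℝ] Euc m := (Real.sqrt s)⁻¹ • Ψ with hL
  have hδ := normDet_pos_of_injective (graphMap_injective φ a)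
  have hLdet : |LinearMap.det L| = (Real.sqrt s)⁻¹ ^ m * (graphMap φ a).normDet := by
    rw [hL, LinearMap.det_smul, finrank_euclideanSpace_fin, abs_mul, hdet, abs_pow, abs_inv,
      abs_of_nonneg (Real.sqrt_nonneg _)]
  have hLpos : 0 < |LinearMap.det L| := by
    rw [hLdet]
    have := Real.sqrt_pos.2 hs
    positivity
  have hpdet : LinearMap.det (piLinear (m + 1) L) ≠ 0 := by
    rw [det_piLinear]
    exact pow_ne_zero _ (abs_pos.1 hLpos)
  have hpt : ∀ u : Fin (m + 1) → Euc m, ENNReal.ofReal |edgeDet u| ^ q *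
      (g (fun i => (Real.sqrt s)⁻¹ • Ψ (u i), w) *
        ∏ i, radialWeight σ β (graphMap φ a (u i) + normalMap φ a y)) =
      (ENNReal.ofReal (s ^ (-β)) ^ (m + 1) * ENNReal.ofReal |LinearMap.det L|⁻¹ ^ q) *
        (g (piLinear (m + 1) L u, w) * vertexWeight m q β (piLinear (m + 1) L u)) := by
    intro u
    have h1 : ENNReal.ofReal |edgeDet u| = ENNReal.ofReal |LinearMap.det L|⁻¹ *
        ENNReal.ofReal |edgeDet (piLinear (m + 1) L u)| := by
      have h2 : edgeDet (piLinear (m + 1) L u) = LinearMap.det L * edgeDet u :=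
        edgeDet_linear L u
      rw [h2, abs_mul, ← ENNReal.ofReal_mul (by positivity), inv_mul_cancel_left₀ hLpos.ne']
    have h3 : ∏ i, radialWeight σ β (graphMap φ a (u i) + normalMap φ a y) =
        ENNReal.ofReal (s ^ (-β)) ^ (m + 1) *
          ∏ i, radialWeight 1 β (piLinear (m + 1) L u i) := by
      simp_rw [radialWeight_graph φ hΨ hs β, Finset.prod_mul_distrib, Finset.prod_const,
        Finset.card_univ, Fintype.card_fin]
      rfl
    have h4 : (fun i => (Real.sqrt s)⁻¹ • Ψ (u i)) = piLinear (m + 1) L u := rfl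
    rw [h1, h3, h4, vertexWeight, mul_pow]
    ring
  simp_rw [hpt]
  rw [lintegral_const_mul' _ _ (by finiteness),
    lintegral_comp_linearMap volume hpdet (fun z => g (z, w) * vertexWeight m q β z), det_piLinear,
    ← mul_assoc, ← mul_assoc]
  -- Of the `m + 1 + q` inverse determinants on the right-hand side, `m + 1` cancel the Jacobian of
  -- the substitution; the other `q` come from `edgeDet`.
  have hone : ENNReal.ofReal |LinearMap.det L|⁻¹ ^ (m + 1) *
      ENNReal.ofReal |LinearMap.det L ^ (m + 1)| = 1 := by
    rw [abs_pow, ENNReal.ofReal_pow (abs_nonneg _), ← mul_pow,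
      ← ENNReal.ofReal_mul (by positivity), inv_mul_cancel₀ hLpos.ne', ENNReal.ofReal_one, one_pow]
  rw [← ENNReal.ofReal_mul (by positivity), ← jacobian_power hs, ← hLdet,
    ENNReal.ofReal_mul (by positivity), ENNReal.ofReal_pow (by positivity),
    ENNReal.ofReal_pow (by positivity), pow_add _ (m + 1) q]
  calc _ = ENNReal.ofReal (s ^ (-β)) ^ (m + 1) * ENNReal.ofReal |LinearMap.det L|⁻¹ ^ q * 1 *
        ∫⁻ u, g (piLinear (m + 1) L u, w) * vertexWeight m q β (piLinear (m + 1) L u) := by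
          rw [mul_one]
    _ = _ := by
          rw [← hone]
          ring

/-- The decomposition formula: in canonical coordinates, integrals of radial weights over generic
tuples split into a product. -/
theorem lintegral_flatSet (β σ : ℝ) (g : (Fin (m + 1) → Euc m) × Euc q → ℝ≥0∞)
    (hg : Measurable g) :
    ∫⁻ x in flatSet E₀ σ, g (innerCoord I E₀ σ x, footCoord hmq J E₀ x) *
      ∏ i, radialWeight σ β (x i) =
    (∫⁻ a, graphJacobian φ a) * ∫⁻ y in radialSet q σ,
      radialWeight σ ((m + 1 : ℝ) * β - (m : ℝ) * (m + 1 + q) / 2) y *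
        ∫⁻ z, g (z, y) * vertexWeight m q β z := by
  set γ := (m + 1 : ℝ) * β - (m : ℝ) * (m + 1 + q) / 2 with hγ
  have hF : Measurable fun x : Fin (m + 1) → Euc d =>
      g (innerCoord I E₀ σ x, footCoord hmq J E₀ x) * ∏ i, radialWeight σ β (x i) :=
    (hg.comp ((measurable_innerCoord I E₀ σ).prodMk (measurable_footCoord hmq J E₀))).mul
      (Finset.measurable_prod _ fun i _ =>
        (measurable_radialWeight σ β).comp (measurable_pi_apply i))
  rw [← lintegral_indicator (measurableSet_flatSet E₀ σ),
    lintegral_tuple_eq φ _ (hF.indicator (measurableSet_flatSet E₀ σ)),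
    ← lintegral_mul_const _ (measurable_graphJacobian φ)]
  refine lintegral_congr fun a => ?_
  obtain ⟨Ω, hΩ, hΩdet, hΩc⟩ := exists_linear_footCoord φ hmq J E₀ a
  have hΩpos : 0 < |LinearMap.det Ω| := by
    rw [hΩdet]
    exact normDet_pos_of_injective (normalMap_injective φ a)
  set G : Euc q → ℝ≥0∞ := (radialSet q σ).indicator fun y =>
    radialWeight σ γ y * ∫⁻ z, g (z, y) * vertexWeight m q β z with hG
  have hinner : ∀ y : Euc q, ∫⁻ u : Fin (m + 1) → Euc m, ENNReal.ofReal |edgeDet u| ^ q *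
      (flatSet E₀ σ).indicator (fun x => g (innerCoord I E₀ σ x, footCoord hmq J E₀ x) *
        ∏ i, radialWeight σ β (x i)) (fun i => graphMap φ a (u i) + normalMap φ a y) =
      ENNReal.ofReal ((graphMap φ a).normDet⁻¹ ^ (m + 1 + q)) * G (Ω y) := by
    intro y
    obtain ⟨Ψ, hΨ, hΨdet, hΨc⟩ := exists_linear_innerCoord φ I E₀ a y
    have hmem : ∀ u : Fin (m + 1) → Euc m, edgeDet u ≠ 0 →
        ((fun i => graphMap φ a (u i) + normalMap φ a y) ∈ flatSet E₀ σ ↔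
          0 < ‖normalMap φ a y‖ ^ 2 + σ) := by
      intro u hu
      rw [flatSet, Set.mem_ofPred_eq, hullGr_graph φ E₀ a y hu, AffGr.dist, foot_graphFlat]
      exact and_iff_right (graph_mem_genericSet φ a y hu)
    -- Membership in `flatSet` depends on `y` alone once `u` is affinely independent; in the second
    -- case both sides vanish.
    by_cases hs : 0 < ‖normalMap φ a y‖ ^ 2 + σ
    · have hy : Ω y ∈ radialSet q σ := by
        rw [radialSet, Set.mem_ofPred_eq, hΩ]
        exact hs
      rw [hG, Set.indicator_of_mem hy, radialWeight, hΩ,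
        ← lintegral_graph_inner φ β hs g (Ω y) hΨ hΨdet]
      refine lintegral_congr_ae ?_
      filter_upwards [ae_edgeDet_ne_zero] with u hu
      rw [Set.indicator_of_mem ((hmem u hu).2 hs), hΨc σ u hu, hΩc y u hu]
    · have hy : Ω y ∉ radialSet q σ := by
        rw [radialSet, Set.mem_ofPred_eq, hΩ]
        exact hs
      rw [hG, Set.indicator_of_notMem hy, mul_zero, lintegral_eq_zero_of_ae_eq_zero]
      filter_upwards [ae_edgeDet_ne_zero] with u hu
      rw [Set.indicator_of_notMem (fun h => hs ((hmem u hu).1 h)), mul_zero]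
      rfl
  simp_rw [hinner]
  rw [lintegral_const_mul' _ _ ENNReal.ofReal_ne_top,
    ← lintegral_indicator (measurableSet_radialSet q σ),
    lintegral_comp_linearMap volume (abs_pos.1 hΩpos) ((radialSet q σ).indicator _), ← hG,
    graphJacobian, ← hΩdet]
  have hone : ENNReal.ofReal |LinearMap.det Ω|⁻¹ * ENNReal.ofReal |LinearMap.det Ω| = 1 := by
    rw [← ENNReal.ofReal_mul (by positivity), inv_mul_cancel₀ hΩpos.ne', ENNReal.ofReal_one]
  calc _ = ENNReal.ofReal |LinearMap.det (footMap a).toLinearMap| *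
        (ENNReal.ofReal ((graphMap φ a).normDet⁻¹ ^ (m + 1 + q)) * 1 * ∫⁻ y, G (Ω y)) := by
          rw [mul_one]
    _ = _ := by
          rw [← hone]
          ring

end Graph

/-! ### Normalizing constants -/

/-- A non-integrable function has Bochner integral 0, so a nonzero value already certifies
integrability. -/
theorem lintegral_ofReal_of_integral_ne_zero {X : Type*} [MeasurableSpace X] {μ : Measure X}
    {f : X → ℝ} (hf : 0 ≤ᵐ[μ] f) (h : ∫ x, f x ∂μ ≠ 0) :
    ∫⁻ x, ENNReal.ofReal (f x) ∂μ = ENNReal.ofReal (∫ x, f x ∂μ) :=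
  (ofReal_integral_eq_lintegral_ofReal (not_imp_comm.1 integral_undef h) hf).symm

theorem lintegral_gamma {b r : ℝ} (hb : 0 < b) (hr : 0 < r) :
    ∫⁻ t in Set.Ioi (0 : ℝ), ENNReal.ofReal (t ^ (b - 1) * Real.exp (-(r * t))) =
      ENNReal.ofReal (r ^ (-b) * Real.Gamma b) := by
  have h := Real.integral_rpow_mul_exp_neg_mul_Ioi hb hr
  have hpos : 0 < (1 / r) ^ b * Real.Gamma b := by
    have := Real.Gamma_pos_of_pos hb
    positivity
  rw [lintegral_ofReal_of_integral_ne_zero, h, one_div, Real.inv_rpow hr.le, Real.rpow_neg hr.le]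
  · refine (ae_restrict_iff' measurableSet_Ioi).2 (Filter.Eventually.of_forall fun t ht => ?_)
    have ht' : (0 : ℝ) < t := ht
    simp only [Pi.zero_apply]
    positivity
  · rw [h]
    exact hpos.ne'

theorem lintegral_gaussian (n : ℕ) {t : ℝ} (ht : 0 < t) :
    ∫⁻ x : Euc n, ENNReal.ofReal (Real.exp (-t * ‖x‖ ^ 2)) =
      ENNReal.ofReal ((Real.pi / t) ^ ((n : ℝ) / 2)) := by
  have h := GaussianFourier.integral_rexp_neg_mul_sq_norm (V := Euc n) ht
  rw [finrank_euclideanSpace_fin] at h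
  have hpos : 0 < (Real.pi / t) ^ ((n : ℝ) / 2) := by
    have := Real.pi_pos
    positivity
  rw [lintegral_ofReal_of_integral_ne_zero, h]
  · exact Filter.Eventually.of_forall fun x => (Real.exp_pos _).le
  · rw [h]
    exact hpos.ne'

theorem cTilde_pos {n : ℕ} {b : ℝ} (hb : (n : ℝ) / 2 < b) : 0 < cTilde n b := by
  have hn : (0 : ℝ) ≤ (n : ℝ) / 2 := by positivity
  have h1 := Real.Gamma_pos_of_pos (hn.trans_lt hb)
  have h2 := Real.Gamma_pos_of_pos (sub_pos.2 hb)
  have h3 := Real.pi_pos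
  unfold cTilde
  positivity

theorem lintegral_radialWeight {n : ℕ} {b : ℝ} (hb : (n : ℝ) / 2 < b) :
    ∫⁻ x : Euc n, radialWeight 1 b x = ENNReal.ofReal (cTilde n b)⁻¹ := by
  have hb0 : 0 < b := lt_of_le_of_lt (by positivity) hb
  have hΓ := Real.Gamma_pos_of_pos hb0
  -- The power is written as a Gamma integral over `t`; after exchanging integrals, the one over `x`
  -- is Gaussian.
  have h1 : ∀ x : Euc n, ENNReal.ofReal (Real.Gamma b) * radialWeight 1 b x =
      ∫⁻ t in Set.Ioi (0 : ℝ), ENNReal.ofReal (t ^ (b - 1) * Real.exp (-((‖x‖ ^ 2 + 1) * t))) := by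
    intro x
    rw [lintegral_gamma hb0 (by positivity), radialWeight, ← ENNReal.ofReal_mul hΓ.le, mul_comm]
  have h2 : ∀ t ∈ Set.Ioi (0 : ℝ), ∫⁻ x : Euc n,
      ENNReal.ofReal (t ^ (b - 1) * Real.exp (-((‖x‖ ^ 2 + 1) * t))) =
      ENNReal.ofReal (Real.pi ^ ((n : ℝ) / 2)) *
        ENNReal.ofReal (t ^ (b - (n : ℝ) / 2 - 1) * Real.exp (-(1 * t))) := by
    intro t ht
    have ht' : (0 : ℝ) < t := ht
    have h3 : ∀ x : Euc n, ENNReal.ofReal (t ^ (b - 1) * Real.exp (-((‖x‖ ^ 2 + 1) * t))) =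
        ENNReal.ofReal (t ^ (b - 1) * Real.exp (-t)) *
          ENNReal.ofReal (Real.exp (-t * ‖x‖ ^ 2)) := by
      intro x
      rw [← ENNReal.ofReal_mul (by positivity), mul_assoc, ← Real.exp_add]
      congr 3
      ring
    simp_rw [h3]
    rw [lintegral_const_mul' _ _ ENNReal.ofReal_ne_top, lintegral_gaussian n ht',
      ← ENNReal.ofReal_mul (by positivity), ← ENNReal.ofReal_mul (by positivity),
      Real.div_rpow Real.pi_pos.le ht'.le, one_mul, sub_right_comm b, Real.rpow_sub ht' (b - 1)]
    congr 1
    ring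
  have hmeas : Measurable fun p : Euc n × ℝ =>
      ENNReal.ofReal (p.2 ^ (b - 1) * Real.exp (-((‖p.1‖ ^ 2 + 1) * p.2))) := by
    fun_prop
  have h4 : ENNReal.ofReal (Real.Gamma b) * ∫⁻ x : Euc n, radialWeight 1 b x =
      ENNReal.ofReal (Real.pi ^ ((n : ℝ) / 2)) *
        ENNReal.ofReal (Real.Gamma (b - (n : ℝ) / 2)) := by
    rw [← lintegral_const_mul' _ _ ENNReal.ofReal_ne_top]
    simp_rw [h1]
    rw [lintegral_lintegral_swap hmeas.aemeasurable, setLIntegral_congr_fun measurableSet_Ioi h2,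
      lintegral_const_mul' _ _ ENNReal.ofReal_ne_top, lintegral_gamma (sub_pos.2 hb) one_pos,
      Real.one_rpow, one_mul]
  have h5 : ENNReal.ofReal (Real.Gamma b)⁻¹ * ENNReal.ofReal (Real.Gamma b) = 1 := by
    rw [← ENNReal.ofReal_mul (by positivity), inv_mul_cancel₀ hΓ.ne', ENNReal.ofReal_one]
  have h6 := Real.Gamma_pos_of_pos (sub_pos.2 hb)
  calc ∫⁻ x : Euc n, radialWeight 1 b x
      = ENNReal.ofReal (Real.Gamma b)⁻¹ *
          (ENNReal.ofReal (Real.Gamma b) * ∫⁻ x : Euc n, radialWeight 1 b x) := by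
        rw [← mul_assoc, h5, one_mul]
    _ = ENNReal.ofReal (cTilde n b)⁻¹ := by
        rw [h4, ← ENNReal.ofReal_mul (by positivity), ← ENNReal.ofReal_mul (by positivity),
          cTilde, inv_div, div_eq_inv_mul (Real.pi ^ ((n : ℝ) / 2) * _)]

/-! ### Product measures with densities -/

theorem lintegral_pi_prod {n : ℕ} {E : Type*} [MeasureSpace E] [SigmaFinite (volume : Measure E)]
    (f : Fin n → E → ℝ≥0∞) (hf : ∀ i, Measurable (f i)) :
    ∫⁻ x : Fin n → E, ∏ i, f i (x i) = ∏ i, ∫⁻ y, f i y := by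
  induction n with
  | zero => simp [volume_pi]
  | succ n ih =>
    have hm₀ : Measurable fun x : Fin (n + 1) → E => ∏ i, f i (x i) :=
      Finset.measurable_prod _ fun i _ => (hf i).comp (measurable_pi_apply i)
    rw [lintegral_fin_succ _ hm₀, Fin.prod_univ_succ]
    simp_rw [Fin.prod_univ_succ, Fin.cons_zero, Fin.cons_succ]
    have hm : Measurable fun w : Fin n → E => ∏ i : Fin n, f i.succ (w i) :=
      Finset.measurable_prod _ fun i _ => (hf i.succ).comp (measurable_pi_apply i)
    simp_rw [lintegral_const_mul _ hm, ih _ fun i => hf i.succ]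
    exact lintegral_mul_const _ (hf 0)

theorem pi_withDensity {n : ℕ} {E : Type*} [MeasureSpace E] [SigmaFinite (volume : Measure E)]
    {f : E → ℝ≥0∞} (hf : Measurable f) [SigmaFinite ((volume : Measure E).withDensity f)] :
    Measure.pi (fun _ : Fin n => (volume : Measure E).withDensity f) =
      volume.withDensity fun x => ∏ i, f (x i) := by
  refine Measure.pi_eq fun s hs => ?_
  rw [withDensity_apply _ (MeasurableSet.univ_pi hs),
    ← lintegral_indicator (MeasurableSet.univ_pi hs)]
  have h : ∀ x : Fin n → E, (Set.univ.pi s).indicator (fun x => ∏ i, f (x i)) x =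
      ∏ i, (s i).indicator f (x i) := by
    intro x
    by_cases hx : x ∈ Set.univ.pi s
    · rw [Set.indicator_of_mem hx]
      exact Finset.prod_congr rfl fun i _ => (Set.indicator_of_mem (hx i trivial) f).symm
    · rw [Set.indicator_of_notMem hx]
      simp only [Set.mem_pi, Set.mem_univ, true_implies, not_forall] at hx
      obtain ⟨i, hi⟩ := hx
      exact (Finset.prod_eq_zero (Finset.mem_univ i) (Set.indicator_of_notMem hi f)).symm
  simp_rw [h]
  rw [lintegral_pi_prod _ fun i => hf.indicator (hs i)]
  refine Finset.prod_congr rfl fun i _ => ?_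
  rw [lintegral_indicator (hs i), withDensity_apply _ (hs i)]

theorem measurable_betaStarDensity (d : ℕ) (α β : ℝ) : Measurable (betaStarDensity d α β) := by
  unfold betaStarDensity
  fun_prop

theorem betaStarMeasure_eq_withDensity (d : ℕ) (α β : ℝ) :
    betaStarMeasure d α β = volume.withDensity
      ((Metric.closedBall (0 : Euc d) 1)ᶜ.indicator
        fun x => ENNReal.ofReal (betaStarDensity d α β x)) := by
  rw [betaStarMeasure, withDensity_indicator measurableSet_closedBall.compl]

theorem ofReal_betaStarDensity {d : ℕ} {α β : ℝ} (hα : 0 < α) (hβ : (d : ℝ) / 2 < β) {x : Euc d}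
    (hx : 1 < ‖x‖) : ENNReal.ofReal (betaStarDensity d α β x) =
      ENNReal.ofReal (α * cTilde d β) * radialWeight (-1) β x := by
  have h := cTilde_pos hβ
  have h1 : 0 < ‖x‖ ^ 2 - 1 := by nlinarith
  rw [radialWeight, ← ENNReal.ofReal_mul (by positivity), betaStarDensity, ← sub_eq_add_neg,
    Real.rpow_neg h1.le, div_eq_mul_inv]

theorem radialSet_neg_one (n : ℕ) :
    radialSet n (-1) = (Metric.closedBall (0 : Euc n) 1)ᶜ := by
  ext x
  rw [radialSet, Set.mem_ofPred_eq, Set.mem_compl_iff, mem_closedBall_zero_iff, not_le]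
  constructor
  · intro h
    nlinarith [norm_nonneg x]
  · intro h
    nlinarith

theorem radialSet_one (n : ℕ) : radialSet n 1 = Set.univ := by
  refine Set.eq_univ_of_forall fun x => ?_
  rw [radialSet, Set.mem_ofPred_eq]
  positivity

/-! ### The canonical decomposition -/

/-! ### Evaluation of the constant and normalization of the simplex weight -/

section Calibration

variable {m q d : ℕ}

theorem ae_mem_genericSet (φ : WithLp 2 (Euc m × Euc q) ≃ₗᵢ[ℝ] Euc d) :
    ∀ᵐ x : Fin (m + 1) → Euc d, x ∈ genericSet m d := by
  have hm := (isOpen_genericSet m d).measurableSet.compl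
  have h : volume (genericSet m d)ᶜ = 0 := by
    rw [← lintegral_indicator_one hm, lintegral_tuple_eq φ _ (measurable_one.indicator hm)]
    have h0 : ∀ (a : Fin m → Euc q) (y : Euc q), ∫⁻ u : Fin (m + 1) → Euc m,
        ENNReal.ofReal |edgeDet u| ^ q * (genericSet m d)ᶜ.indicator 1
          (fun i => graphMap φ a (u i) + normalMap φ a y) = 0 := by
      intro a y
      rw [lintegral_eq_zero_of_ae_eq_zero]
      filter_upwards [ae_edgeDet_ne_zero] with u hu
      rw [Set.indicator_of_notMem (Set.notMem_compl_iff.2 (graph_mem_genericSet φ a y hu)), mul_zero]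
      rfl
    simp_rw [h0]
    simp
  rw [ae_iff]
  exact h

/-- The difference of the two sides is exactly `(m + 1)(β - d/2)`. -/
theorem codim_div_two_lt {β : ℝ} (hmq : m + q = d) (hβ : (d : ℝ) / 2 < β) :
    (q : ℝ) / 2 < (m + 1 : ℝ) * β - (m : ℝ) * (m + 1 + q) / 2 := by
  have hd : (d : ℝ) = m + q := by
    rw [← hmq]
    push_cast
    ring
  rw [hd] at hβ
  have hm : (0 : ℝ) ≤ m := Nat.cast_nonneg m
  nlinarith

/-- The constants in the decomposition formula, obtained by integrating the product of beta-prime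
densities over all tuples. -/
theorem lintegral_graphJacobian_mul (φ : WithLp 2 (Euc m × Euc q) ≃ₗᵢ[ℝ] Euc d)
    (hmq : m + q = d) (I : IsometrySystem d m) (J : IsometrySystem d q) {β : ℝ}
    (hβ : (d : ℝ) / 2 < β) :
    (∫⁻ a, graphJacobian φ a) * (ENNReal.ofReal
      (cTilde q ((m + 1 : ℝ) * β - (m : ℝ) * (m + 1 + q) / 2))⁻¹ * ∫⁻ z, vertexWeight m q β z) =
      ENNReal.ofReal (cTilde d β)⁻¹ ^ (m + 1) := by
  have E₀ : AffGr d m := graphFlat φ 0 0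
  -- With `σ = 1` the radial constraint is void and generic tuples have full measure, so the left
  -- side is a product of `m + 1` beta-prime integrals.
  have h := lintegral_flatSet φ hmq I J E₀ β 1 1 measurable_one
  have hflat : (flatSet E₀ 1 : Set (Fin (m + 1) → Euc d)) =ᵐ[volume] Set.univ := by
    rw [Filter.eventuallyEq_univ]
    filter_upwards [ae_mem_genericSet φ] with x hx
    refine ⟨hx, ?_⟩
    positivity
  simp only [Pi.one_apply, one_mul] at h
  rw [setLIntegral_congr hflat, setLIntegral_univ,
    lintegral_pi_prod _ (fun _ => measurable_radialWeight 1 β), Finset.prod_const, Finset.card_univ,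
    Fintype.card_fin, lintegral_radialWeight hβ, radialSet_one, setLIntegral_univ,
    lintegral_mul_const _ (measurable_radialWeight _ _),
    lintegral_radialWeight (codim_div_two_lt hmq hβ)] at h
  exact h.symm

/-- The calibration identity makes a product containing this integral positive and finite. So
neither it nor the slope integral is 0, and an infinite value would make the product infinite. -/
theorem lintegral_vertexWeight_ne (φ : WithLp 2 (Euc m × Euc q) ≃ₗᵢ[ℝ] Euc d)
    (hmq : m + q = d) (I : IsometrySystem d m) (J : IsometrySystem d q) {β : ℝ}
    (hβ : (d : ℝ) / 2 < β) :
    ∫⁻ z, vertexWeight m q β z ≠ 0 ∧ ∫⁻ z, vertexWeight m q β z ≠ ∞ := by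
  have h := lintegral_graphJacobian_mul φ hmq I J hβ
  have hd : 0 < (cTilde d β)⁻¹ := inv_pos.2 (cTilde_pos hβ)
  have hq : 0 < (cTilde q ((m + 1 : ℝ) * β - (m : ℝ) * (m + 1 + q) / 2))⁻¹ :=
    inv_pos.2 (cTilde_pos (codim_div_two_lt hmq hβ))
  have hne : ENNReal.ofReal (cTilde d β)⁻¹ ^ (m + 1) ≠ 0 :=
    pow_ne_zero _ (ENNReal.ofReal_pos.2 hd).ne'
  have htop : ENNReal.ofReal (cTilde d β)⁻¹ ^ (m + 1) ≠ ∞ :=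
    ENNReal.pow_ne_top ENNReal.ofReal_ne_top
  have h0 : ∫⁻ z, vertexWeight m q β z ≠ 0 := by
    intro h0
    rw [h0, mul_zero, mul_zero] at h
    exact hne h.symm
  refine ⟨h0, fun ht => ?_⟩
  rw [ht, ENNReal.mul_top (ENNReal.ofReal_pos.2 hq).ne', ENNReal.mul_top] at h
  · exact htop h.symm
  · intro hK
    rw [hK, zero_mul] at h
    exact hne h.symm

theorem simplexWeight_eq {β : ℝ} (hβ : (m : ℝ) / 2 < β) (z : Fin (m + 1) → Euc m) :
    volume (convexHull ℝ (Set.range z)) ^ q * ∏ i, ENNReal.ofReal (betaPrimeDensity m β (z i)) =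
      (volume (convexHull ℝ (Set.range (stdVertices m))) ^ q *
        ENNReal.ofReal (cTilde m β) ^ (m + 1)) * vertexWeight m q β z := by
  have h : ∀ i, ENNReal.ofReal (betaPrimeDensity m β (z i)) =
      ENNReal.ofReal (cTilde m β) * radialWeight 1 β (z i) := by
    intro i
    rw [betaPrimeDensity, ENNReal.ofReal_mul (cTilde_pos hβ).le, radialWeight, add_comm]
  simp_rw [h, Finset.prod_mul_distrib, Finset.prod_const, Finset.card_univ, Fintype.card_fin]
  rw [volume_convexHull_eq, vertexWeight, mul_pow]
  ring

/-- Normalization of a density is insensitive to constant factors. -/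
theorem withDensity_normalize_const_mul {X : Type*} [MeasurableSpace X] (μ : Measure X)
    {C : ℝ≥0∞} (hC : C ≠ 0) (hC' : C ≠ ∞) (w : X → ℝ≥0∞) :
    (μ.withDensity fun z => (∫⁻ x, C * w x ∂μ)⁻¹ * (C * w z)) =
      μ.withDensity fun z => (∫⁻ x, w x ∂μ)⁻¹ * w z := by
  congr 1
  funext z
  rw [lintegral_const_mul' _ _ hC', ENNReal.mul_inv (Or.inl hC) (Or.inl hC'), mul_mul_mul_comm,
    ENNReal.inv_mul_cancel hC hC', one_mul]

theorem isProbabilityMeasure_normalize {X : Type*} [MeasurableSpace X] (μ : Measure X)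
    {w : X → ℝ≥0∞} (h0 : ∫⁻ x, w x ∂μ ≠ 0) (ht : ∫⁻ x, w x ∂μ ≠ ∞) :
    IsProbabilityMeasure (μ.withDensity fun z => (∫⁻ x, w x ∂μ)⁻¹ * w z) := by
  refine ⟨?_⟩
  rw [withDensity_apply _ MeasurableSet.univ, setLIntegral_univ,
    lintegral_const_mul' _ _ (ENNReal.inv_ne_top.2 h0), ENNReal.inv_mul_cancel h0 ht]

/-- The normalization of `vertexWeight` to a probability measure. -/
def vertexMeasure (m q : ℕ) (β : ℝ) : Measure (Fin (m + 1) → Euc m) :=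
  volume.withDensity fun z => (∫⁻ w, vertexWeight m q β w)⁻¹ * vertexWeight m q β z

theorem simplexMeasure_eq_vertexMeasure {β : ℝ} (hq : d - (m + 1) + 1 = q)
    (hβ : (m : ℝ) / 2 < β) : simplexMeasure d (m + 1) β = vertexMeasure m q β := by
  subst hq
  have hc := ENNReal.ofReal_pos.2 (cTilde_pos hβ)
  have h : simplexWeight d (m + 1) β = fun z => (volume (convexHull ℝ (Set.range (stdVertices m))) ^
      (d - (m + 1) + 1) * ENNReal.ofReal (cTilde m β) ^ (m + 1)) *
        vertexWeight m (d - (m + 1) + 1) β z := by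
    funext z
    exact simplexWeight_eq hβ z
  rw [simplexMeasure, h]
  refine withDensity_normalize_const_mul volume ?_ ?_ _
  · exact mul_ne_zero (pow_ne_zero _ (volume_stdSimplex_ne_zero m)) (pow_ne_zero _ hc.ne')
  · exact ENNReal.mul_ne_top (ENNReal.pow_ne_top (volume_stdSimplex_ne_top m))
      (ENNReal.pow_ne_top ENNReal.ofReal_ne_top)

end Calibration

/-! ### The beta-star case and the pushforward identity -/

section Decomposition

variable {m q d : ℕ}

/-- The foot is the point of the flat nearest to the origin, so the flat misses the closed ball
exactly when `dist > 1`. The default `E₀` plays no role, because both sets contain only generic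
tuples. -/
theorem flatSet_neg_one_eq (E₀ : AffGr d m) : flatSet E₀ (-1) = tupleSet (m + 1) d := by
  ext x
  have key : ∀ hx : x ∈ genericSet m d, (0 < (hullGr E₀ x).dist ^ 2 + (-1) ↔
      (affineSpan ℝ (Set.range x) : Set (Euc d)) ∩ Metric.closedBall 0 1 = ∅) := by
    intro hx
    rw [hullGr_of_mem E₀ hx]
    set E := genericHull ⟨x, hx⟩ with hE
    have hEx : E.1 = affineSpan ℝ (Set.range x) := rfl
    have h0 : 0 ≤ E.dist := norm_nonneg _
    rw [← hEx]
    constructor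
    · intro h
      rw [Set.eq_empty_iff_forall_notMem]
      rintro p ⟨hp, hp1⟩
      rw [mem_closedBall_zero_iff] at hp1
      have hdiff : p - E.foot ∈ E.1.direction := E.1.vsub_mem_direction hp E.foot.2
      have hinner := E.foot_mem_direction_orthogonal _ hdiff
      have hsq := norm_add_sq_eq_norm_sq_add_norm_sq_of_inner_eq_zero _ _ hinner
      rw [sub_add_cancel] at hsq
      have hd : E.dist = ‖(E.foot : Euc d)‖ := rfl
      rw [hd] at h
      nlinarith [norm_nonneg p, norm_nonneg (p - E.foot)]
    · intro h
      have hfoot : (E.foot : Euc d) ∉ Metric.closedBall (0 : Euc d) 1 := by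
        intro hmem
        have hm : (E.foot : Euc d) ∈ (E.1 : Set (Euc d)) ∩ Metric.closedBall 0 1 :=
          ⟨E.foot.2, hmem⟩
        rw [h] at hm
        exact hm
      rw [mem_closedBall_zero_iff, not_le] at hfoot
      have hd : 1 < E.dist := hfoot
      nlinarith
  constructor
  · rintro ⟨hx, h⟩
    exact ⟨(key hx).1 h, hx⟩
  · rintro ⟨h, hx⟩
    exact ⟨hx, (key hx).2 h⟩

theorem one_lt_norm_of_mem_tupleSet {k : ℕ} {x : Fin k → Euc d} (hx : x ∈ tupleSet k d)
    (i : Fin k) : 1 < ‖x i‖ := by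
  by_contra h
  have hm : x i ∈ (affineSpan ℝ (Set.range x) : Set (Euc d)) ∩ Metric.closedBall 0 1 :=
    ⟨mem_affineSpan ℝ ⟨i, rfl⟩, by simpa using h⟩
  rw [hx.1] at hm
  exact hm

theorem setLIntegral_pi_betaStarMeasure {k : ℕ} {α β : ℝ} (hα : 0 < α) (hβ : (d : ℝ) / 2 < β)
    (hS : MeasurableSet (tupleSet k d)) {G : (Fin k → Euc d) → ℝ≥0∞} (hG : Measurable G) :
    ∫⁻ x in tupleSet k d, G x ∂(Measure.pi fun _ => betaStarMeasure d α β) =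
      ENNReal.ofReal (α * cTilde d β) ^ k *
        ∫⁻ x in tupleSet k d, G x * ∏ i, radialWeight (-1) β (x i) := by
  set f : Euc d → ℝ≥0∞ := (Metric.closedBall (0 : Euc d) 1)ᶜ.indicator
    fun x => ENNReal.ofReal (betaStarDensity d α β x) with hf
  have hfm : Measurable f :=
    (measurable_betaStarDensity d α β).ennreal_ofReal.indicator measurableSet_closedBall.compl
  have hpi : (Measure.pi fun _ : Fin k => betaStarMeasure d α β) =
      volume.withDensity fun x => ∏ i, f (x i) := by
    have hsf : SigmaFinite ((volume : Measure (Euc d)).withDensity f) := by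
      rw [hf, ← betaStarMeasure_eq_withDensity]
      infer_instance
    rw [← pi_withDensity hfm]
    congr 1
    funext _
    exact betaStarMeasure_eq_withDensity d α β
  have hfp : Measurable fun x : Fin k → Euc d => ∏ i, f (x i) :=
    Finset.measurable_prod _ fun i _ => hfm.comp (measurable_pi_apply i)
  rw [hpi, setLIntegral_withDensity_eq_setLIntegral_mul volume hfp hG hS,
    ← lintegral_const_mul' _ _ (ENNReal.pow_ne_top ENNReal.ofReal_ne_top)]
  -- On `tupleSet` each point lies on a flat missing the ball, so the indicators in the densities
  -- all equal 1.
  refine setLIntegral_congr_fun hS fun x hx => ?_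
  have h : ∀ i, f (x i) = ENNReal.ofReal (α * cTilde d β) * radialWeight (-1) β (x i) := by
    intro i
    have hi := one_lt_norm_of_mem_tupleSet hx i
    rw [hf, Set.indicator_of_mem (by simpa using hi), ofReal_betaStarDensity hα hβ hi]
  simp only [Pi.mul_apply, h, Finset.prod_mul_distrib, Finset.prod_const, Finset.card_univ,
    Fintype.card_fin]
  ring

theorem lintegral_vertexMeasure_prod {α γ β : ℝ} (hα : 0 < α) (hγ : (q : ℝ) / 2 < γ) (k : ℕ)
    [SFinite (vertexMeasure m q β)]
    {g : (Fin (m + 1) → Euc m) × Euc q → ℝ≥0∞} (hg : Measurable g) :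
    ∫⁻ p, g p ∂((vertexMeasure m q β).prod (betaStarMeasure q (α ^ k) γ)) =
      ENNReal.ofReal (α ^ k * cTilde q γ) * ((∫⁻ z, vertexWeight m q β z)⁻¹ *
        ∫⁻ y in radialSet q (-1), radialWeight (-1) γ y * ∫⁻ z, g (z, y) * vertexWeight m q β z) := by
  have hw := measurable_vertexWeight m q β
  have hinner : ∀ y, ∫⁻ z, g (z, y) ∂(vertexMeasure m q β) =
      (∫⁻ z, vertexWeight m q β z)⁻¹ * ∫⁻ z, g (z, y) * vertexWeight m q β z := by
    intro y
    have hgy : Measurable fun z => g (z, y) := hg.comp measurable_prodMk_right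
    rw [vertexMeasure, lintegral_withDensity_eq_lintegral_mul _ (hw.const_mul _) hgy,
      ← lintegral_const_mul _ (show Measurable fun z => g (z, y) * vertexWeight m q β z from
        hgy.mul hw)]
    refine lintegral_congr fun z => ?_
    simp only [Pi.mul_apply]
    ring
  have hG : Measurable fun y => ∫⁻ z, g (z, y) * vertexWeight m q β z :=
    (hg.mul (hw.comp measurable_fst)).lintegral_prod_left'
  have hrad : Measurable fun y : Euc q =>
      radialWeight (-1) γ y * ∫⁻ z, g (z, y) * vertexWeight m q β z :=
    (measurable_radialWeight _ _).mul hG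
  rw [lintegral_prod_symm' g hg]
  simp_rw [hinner]
  rw [betaStarMeasure, lintegral_withDensity_eq_lintegral_mul _
    (measurable_betaStarDensity q (α ^ k) γ).ennreal_ofReal (hG.const_mul _), ← radialSet_neg_one,
    ← lintegral_const_mul _ hrad,
    ← lintegral_const_mul' _ _ ENNReal.ofReal_ne_top]
  refine setLIntegral_congr_fun (measurableSet_radialSet q (-1)) fun y hy => ?_
  have hy' : 1 < ‖y‖ := by
    rw [radialSet_neg_one] at hy
    simpa using hy
  simp only [Pi.mul_apply, ofReal_betaStarDensity (pow_pos hα k) hγ hy']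
  ring

/-- The canonical decomposition, in terms of coordinates defined on all tuples. -/
theorem map_pi_betaStarMeasure (φ : WithLp 2 (Euc m × Euc q) ≃ₗᵢ[ℝ] Euc d) (hmq : m + q = d)
    (I : IsometrySystem d m) (J : IsometrySystem d q) (E₀ : AffGr d m) {α β : ℝ} (hα : 0 < α)
    (hβ : (d : ℝ) / 2 < β) :
    ((Measure.pi fun _ : Fin (m + 1) => betaStarMeasure d α β).restrict (tupleSet (m + 1) d)).map
      (fun x => (innerCoord I E₀ (-1) x, footCoord hmq J E₀ x)) =
    (vertexMeasure m q β).prod (betaStarMeasure q (α ^ (m + 1))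
      ((m + 1 : ℝ) * β - (m : ℝ) * (m + 1 + q) / 2)) := by
  set γ := (m + 1 : ℝ) * β - (m : ℝ) * (m + 1 + q) / 2 with hγ_def
  have hγ : (q : ℝ) / 2 < γ := codim_div_two_lt hmq hβ
  obtain ⟨h0, ht⟩ := lintegral_vertexWeight_ne φ hmq I J hβ
  have hK := lintegral_graphJacobian_mul φ hmq I J hβ
  have : IsProbabilityMeasure (vertexMeasure m q β) := isProbabilityMeasure_normalize _ h0 ht
  have hT : Measurable fun x : Fin (m + 1) → Euc d =>
      (innerCoord I E₀ (-1) x, footCoord hmq J E₀ x) :=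
    (measurable_innerCoord I E₀ (-1)).prodMk (measurable_footCoord hmq J E₀)
  refine Measure.ext_of_lintegral _ fun g hg => ?_
  have hgT : Measurable fun x : Fin (m + 1) → Euc d =>
      g (innerCoord I E₀ (-1) x, footCoord hmq J E₀ x) := hg.comp hT
  have hS : MeasurableSet (tupleSet (m + 1) d) := by
    rw [← flatSet_neg_one_eq E₀]
    exact measurableSet_flatSet E₀ (-1)
  rw [lintegral_map hg hT, setLIntegral_pi_betaStarMeasure hα hβ hS hgT,
    lintegral_vertexMeasure_prod hα hγ (m + 1) hg, ← flatSet_neg_one_eq E₀]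
  have hmain := lintegral_flatSet φ hmq I J E₀ β (-1) g hg
  rw [hmain, ← hγ_def, ← mul_assoc, ← mul_assoc]
  congr 1
  rw [← hγ_def] at hK
  have hd := cTilde_pos hβ
  have hq := cTilde_pos hγ
  have e1 : ENNReal.ofReal (cTilde q γ) * ENNReal.ofReal (cTilde q γ)⁻¹ = 1 := by
    rw [← ENNReal.ofReal_mul hq.le, mul_inv_cancel₀ hq.ne', ENNReal.ofReal_one]
  have e2 : ENNReal.ofReal (cTilde d β) * ENNReal.ofReal (cTilde d β)⁻¹ = 1 := by
    rw [← ENNReal.ofReal_mul hd.le, mul_inv_cancel₀ hd.ne', ENNReal.ofReal_one]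
  have e3 : ENNReal.ofReal (cTilde d β) ^ (m + 1) * ENNReal.ofReal (cTilde d β)⁻¹ ^ (m + 1) = 1 := by
    rw [← mul_pow, e2, one_pow]
  rw [ENNReal.ofReal_mul hα.le, mul_pow, ENNReal.ofReal_mul (pow_pos hα _).le,
    ENNReal.ofReal_pow hα.le]
  set A := ENNReal.ofReal α ^ (m + 1)
  set D := ENNReal.ofReal (cTilde d β) ^ (m + 1)
  set Q := ENNReal.ofReal (cTilde q γ)
  set Q' := ENNReal.ofReal (cTilde q γ)⁻¹
  set K := ∫⁻ a, graphJacobian φ a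
  set W := ∫⁻ z, vertexWeight m q β z
  have e4 : W * W⁻¹ = 1 := ENNReal.mul_inv_cancel h0 ht
  -- Factors equal to 1 are inserted so that the unknown `K` appears only in `K * (Q' * W)`, whose
  -- value was fixed by the case `σ = 1`.
  calc A * D * K = A * D * K * (Q * Q') * (W * W⁻¹) := by rw [e1, e4, mul_one, mul_one]
    _ = A * Q * W⁻¹ * D * (K * (Q' * W)) := by ring
    _ = A * Q * W⁻¹ * (D * ENNReal.ofReal (cTilde d β)⁻¹ ^ (m + 1)) := by rw [hK, mul_assoc _ D]
    _ = A * Q * W⁻¹ := by rw [e3, mul_one]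

end Decomposition

/-- The canonical decomposition of a tuple of beta-star points. -/
theorem canonical_decomposition (d k : ℕ) (hk : 1 ≤ k) (hkd : k ≤ d) (α β : ℝ) (hα : 0 < α)
    (hβ : (d : ℝ) / 2 < β) (I : IsometrySystem d (k - 1))
    (J : IsometrySystem d (d - k + 1)) :
    IsProbabilityMeasure (simplexMeasure d k β) ∧
    (tupleMeasure k d α β).map (T hk hkd I J) =
      (simplexMeasure d k β).prod
        ((tupleMeasure k d α β).map (T₂ hk hkd J)) ∧
    (tupleMeasure k d α β).map (T₂ hk hkd J) =
      betaStarMeasure (d - k + 1) (α ^ k)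
        ((k : ℝ) * β - ((d : ℝ) + 1) * ((k : ℝ) - 1) / 2) := by
  obtain ⟨m, rfl⟩ : ∃ m, k = m + 1 := ⟨k - 1, by omega⟩
  have hmq : m + (d - (m + 1) + 1) = d := by omega
  have hdq : (d : ℝ) = m + ((d - (m + 1) + 1 : ℕ) : ℝ) := by
    rw [← Nat.cast_add, hmq]
  -- Concatenation of coordinates; any isometric splitting would do, as `φ` does not enter the
  -- conclusion.
  let φ : WithLp 2 (Euc m × Euc (d - (m + 1) + 1)) ≃ₗᵢ[ℝ] Euc d :=
    (((EuclideanSpace.basisFun (Fin m) ℝ).prod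
      (EuclideanSpace.basisFun (Fin (d - (m + 1) + 1)) ℝ)).reindex
        (finSumFinEquiv.trans (finCongr hmq))).repr
  have E₀ : AffGr d m := graphFlat φ 0 0
  have hβm : (m : ℝ) / 2 < β := by
    have : (0 : ℝ) ≤ ((d - (m + 1) + 1 : ℕ) : ℝ) := Nat.cast_nonneg _
    linarith
  obtain ⟨h0, ht⟩ := lintegral_vertexWeight_ne φ hmq I J hβ
  have hsimplex := simplexMeasure_eq_vertexMeasure (d := d) rfl hβm
  have hprob : IsProbabilityMeasure (simplexMeasure d (m + 1) β) := by
    rw [hsimplex]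
    exact isProbabilityMeasure_normalize _ h0 ht
  have hγ : ((m + 1 : ℕ) : ℝ) * β - ((d : ℝ) + 1) * (((m + 1 : ℕ) : ℝ) - 1) / 2 =
      (m + 1 : ℝ) * β - (m : ℝ) * (m + 1 + ((d - (m + 1) + 1 : ℕ) : ℝ)) / 2 := by
    rw [hdq]
    push_cast
    ring
  have hS : MeasurableSet (tupleSet (m + 1) d) := by
    rw [← flatSet_neg_one_eq E₀]
    exact measurableSet_flatSet E₀ (-1)
  have hTm : Measurable fun x : Fin (m + 1) → Euc d =>
      (innerCoord (m := m) I E₀ (-1) x, footCoord hmq J E₀ x) :=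
    (measurable_innerCoord (m := m) I E₀ (-1)).prodMk (measurable_footCoord hmq J E₀)
  have hT : T hk hkd I J = (fun x : Fin (m + 1) → Euc d =>
      (innerCoord (m := m) I E₀ (-1) x, footCoord hmq J E₀ x)) ∘ Subtype.val := by
    funext x
    have hx : x.1 ∈ genericSet m d := x.2.2
    have hhull : hullGr E₀ x.1 = hull hk x := hullGr_of_mem E₀ hx
    refine Prod.ext ?_ ?_
    · funext i
      change T₁ hk I x i = innerCoord (m := m) I E₀ (-1) x.1 i
      rw [innerCoord, hhull, ← sub_eq_add_neg,
        AffGr.proj_of_mem (hull hk x) (mem_affineSpan ℝ ⟨i, rfl⟩)]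
      rfl
    · change T₂ hk hkd J x = footCoord hmq J E₀ x.1
      rw [footCoord, hhull,
        AffGr.proj_of_mem (perpGr hmq (hull hk x)) ((hull hk x).foot_mem_perp hk hkd)]
      rfl
  have hmap : (tupleMeasure (m + 1) d α β).map (T hk hkd I J) =
      (simplexMeasure d (m + 1) β).prod (betaStarMeasure (d - (m + 1) + 1) (α ^ (m + 1))
        (((m + 1 : ℕ) : ℝ) * β - ((d : ℝ) + 1) * (((m + 1 : ℕ) : ℝ) - 1) / 2)) := by
    rw [hT, ← Measure.map_map hTm measurable_subtype_coe, tupleMeasure, map_comap_subtype_coe hS,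
      hγ, hsimplex]
    exact map_pi_betaStarMeasure φ hmq I J E₀ hα hβ
  have hTmeas : Measurable (T hk hkd I J) := by
    rw [hT]
    exact hTm.comp measurable_subtype_coe
  have hmap₂ : (tupleMeasure (m + 1) d α β).map (T₂ hk hkd J) =
      betaStarMeasure (d - (m + 1) + 1) (α ^ (m + 1))
        (((m + 1 : ℕ) : ℝ) * β - ((d : ℝ) + 1) * (((m + 1 : ℕ) : ℝ) - 1) / 2) := by
    have h : (tupleMeasure (m + 1) d α β).map (T₂ hk hkd J) =
        ((tupleMeasure (m + 1) d α β).map (T hk hkd I J)).map Prod.snd := by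
      rw [Measure.map_map measurable_snd hTmeas]
      rfl
    -- The law of `T₂` is the second marginal of the product; total mass 1 of the first factor
    -- leaves its constant unchanged.
    rw [h, hmap, Measure.map_snd_prod, measure_univ, one_smul]
  exact ⟨hprob, by rw [hmap, hmap₂], hmap₂⟩

end BetaStar

end

theorem theorem4p2 (d k : ℕ) (hk : 1 ≤ k) (hkd : k ≤ d) (α β : ℝ) (hα : 0 < α)
    (hβ : (d : ℝ) / 2 < β) (I : BetaStar.IsometrySystem d (k - 1))
    (J : BetaStar.IsometrySystem d (d - k + 1)) :
    MeasureTheory.IsProbabilityMeasure (BetaStar.simplexMeasure d k β) ∧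
    (BetaStar.tupleMeasure k d α β).map (BetaStar.T hk hkd I J) =
      (BetaStar.simplexMeasure d k β).prod
        ((BetaStar.tupleMeasure k d α β).map (BetaStar.T₂ hk hkd J)) ∧
    (BetaStar.tupleMeasure k d α β).map (BetaStar.T₂ hk hkd J) =
      BetaStar.betaStarMeasure (d - k + 1) (α ^ k)
        ((k : ℝ) * β - ((d : ℝ) + 1) * ((k : ℝ) - 1) / 2) :=
  BetaStar.canonical_decomposition d k hk hkd α β hα hβ I J
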